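/- **Setting.** Consider a finite-horizon MDP with finite state space $\mathcal S$, $|\mathcal S|=S$, finite nonempty action space $\mathcal A$, $|\mathcal A|=A$, horizon $H$, transition probabilities $P_h(y\mid s,a)$ and random costs $C_h(s,a)\in[0,1]$ with mean $c_h(s,a)$, $1\le h\le H$. For a policy $\pi$ let $V_h^\pi(s)=\mathbb E[\sum_{h'=h}^H c_{h'}(s_{h'},a_{h'})\mid s_h=s,\pi,P]$ and $V_h^*(s)=\min_\pi V_h^\pi(s)$. Fix $K\in\mathbb N$ and $\delta\in(0,1)$, and put $\delta'=\delta/5$, $T=HK$, $C_0=\sqrt{S^3AH^3}$. The step sizes are nonincreasing with $c_1/\sqrt{H^2At}\le\eta_t\le c_2/\sqrt{H^2At}$ for $1\le t\le K$, where $0<c_1\le c_2$ are constants. **Algorithm (RPO-SAT).** Start with $\pi^1_h(\cdot\mid s)$ uniform and $V^{\mathrm{ref}}=0$. In each episode $k=1,\dots,K$, started at a fixed state $s_1$, play $\pi^k$: given the past, draw $a_h^k\sim\pi^k_h(\cdot\mid s_h^k)$, then the cost from the law of $C_h(s_h^k,a_h^k)$, then $s_{h+1}^k\sim P_h(\cdot\mid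 s_h^k,a_h^k)$. Let $n_h^k(s)$, $n_h^k(s,a)$ be the visit counts and $\bar c_h^k$, $\bar P_h^k$ the empirical mean costs and transition frequencies after episode $k$ (zero for unvisited pairs); counts in the denominators below are replaced by their maximum with $1$. With $V_{H+1}^k=0$, for $h=H,\dots,1$ compute $$Q_h^k(s,a)=\max\Bigl\{\bar c_h^k(s,a)+\sum_y\bar P_h^k(y\mid s,a)V_{h+1}^k(y)-b_h^k(s,a),\,0\Bigr\},\qquad V_h^k(s)=\sum_aQ_h^k(s,a)\pi_h^k(a\mid s).$$ Here, writing $n=n_h^k(s,a)$, $\bar P=\bar P_h^k(\cdot\mid s,a)$, $L=\ln\frac{2SAHK}{\delta'}$, $L_2=\ln\frac{2SAHT}{\delta'}$, $L_3=\ln\frac{3SAHT}{\delta'}$, $$b_h^k(s,a)=\min\Bigl\{u_h^k(s,a),\ \sqrt{2L_2/n}+H\sqrt{4SL_3/n}\Bigr\},$$ $$\begin{aligned}u_h^k(s,a)={}&\sqrt{\tfrac{2L_2}{n}}+\sqrt{\tfrac{6\,\mathrm{Var}_{Y\sim\bar P}(V^{\mathrm{ref}}_{h+1}(Y))\,L}{n}}+\sqrt{\tfrac{4HL}{Sn}}+\tfrac{8\sqrt{SH^2}\,L}{3n}\\&+\sum_{y}\Bigl(\sqrt{\tfrac{2\bar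 P(y)(1-\bar P(y))L}{n-1}}+\tfrac{7L}{3n}\Bigr)\bigl|V_{h+1}^k(y)-V^{\mathrm{ref}}_{h+1}(y)\bigr|\\&+\sqrt{\tfrac{4HL_3}{n}}+\tfrac{7SHL}{3n}+\tfrac{2S^{3/2}A^{1/4}H^{7/4}K^{1/4}\sqrt L}{n},\end{aligned}$$ with the current $V^{\mathrm{ref}}$. Then set $$\pi_h^{k+1}(\cdot\mid s)=\operatorname*{argmin}_{x\in\Delta(\mathcal A)}\ \eta_k\langle Q_h^k(s,\cdot),x-\pi_h^k(\cdot\mid s)\rangle+\|x-\pi_h^k(\cdot\mid s)\|_2^2,$$ and for every $(h,s)$ with $n_h^k(s)\ge C_0\sqrt k$ put $V_h^{\mathrm{ref}}(s)=\frac1{n_h^k(s)}\sum_{i=1}^kV_h^i(s_h^i)\mathbf 1[s_h^i=s]$. *Optimism* is the event that for all $k\le K$, $h\le H$, $s\in\mathcal S$, $a\in\mathcal A$, $$-2b_h^k(s,a)\le Q_h^k(s,a)-c_h(s,a)-\sum_yP_h(y\mid s,a)V_{h+1}^k(y)\le0.$$ The $h$-th step regret is $\operatorname{Regret}_h(K')=\sum_{k=1}^{K'}\bigl(V_h^{\pi^k}(s_h^k)-V_h^*(s_h^k)\bigr)$.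 **Lemma (average convergence of $V^k$).** There are constants $C>0$ and $p\in\mathbb N$, depending only on $c_1,c_2$, such that in every such setting, with $B(K')=C\bigl(\ln\frac{2SAHK}{\delta}\bigr)^p\sqrt{S^2AH^4K'}$, the following holds. The probability that optimism holds but not all of the bounds $$\operatorname{Regret}_h(K')\le B(K')\qquad\text{and}\qquad\sum_{k=1}^{K'}\bigl|V_h^k(s_h^k)-V_h^*(s_h^k)\bigr|\le B(K')\qquad(0\le K'\le K,\ 1\le h\le H)$$ hold is at most $\delta$. In other words, under optimism, with high probability $\operatorname{Regret}_h(K')\le\tilde O(\sqrt{S^2AH^4K'})$ for all $K'\le K$ and $h\le H$, and hence the Stable-at-Any-Time property $\sum_{k\le K'}|V_h^k(s_h^k)-V_h^*(s_h^k)|\le\tilde O(\sqrt{S^2AH^4K'})$ holds. -/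

import Mathlib

noncomputable section

namespace RPOSAT

open MeasureTheory

/-! ### Finite-horizon Markov decision processes

Steps are numbered `1, …, H`; entries of step-indexed objects at other indices play no role. -/

/-- A finite-horizon MDP with time-dependent transitions and random costs in `[0, 1]`:
`P h s a y` is the probability of moving from `s` to `y` under action `a` at step `h`, and
`costLaw h s a` is the law of the cost `C_h(s, a)`. -/
structure MDP (𝒮 𝒜 : Type*) [Fintype 𝒮] where
  P : ℕ → 𝒮 → 𝒜 → 𝒮 → ℝ
  P_mem : ∀ h s a, P h s a ∈ stdSimplex ℝ 𝒮
  costLaw : ℕ → 𝒮 → 𝒜 → Measure ℝ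
  costLaw_prob : ∀ h s a, IsProbabilityMeasure (costLaw h s a)
  costLaw_support : ∀ h s a, costLaw h s a (Set.Icc 0 1)ᶜ = 0

/-- Stochastic policies: `π h s` is a distribution over actions. -/
abbrev Policy (𝒮 𝒜 : Type*) [Fintype 𝒜] :=
  {π : ℕ → 𝒮 → 𝒜 → ℝ // ∀ h s, π h s ∈ stdSimplex ℝ 𝒜}

section Values

variable {𝒮 𝒜 : Type*} [Fintype 𝒮] [Fintype 𝒜]

/-- The mean cost `c_h(s, a)`. -/
def MDP.c (M : MDP 𝒮 𝒜) (h : ℕ) (s : 𝒮) (a : 𝒜) : ℝ := ∫ x, x ∂(M.costLaw h s a)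

/-- The probability, under `π`, that starting from `s_h = s` the next `n` (action, next state)
pairs `(a_h, s_{h+1}), (a_{h+1}, s_{h+2}), …` are those listed in `τ`. -/
def pathProb (M : MDP 𝒮 𝒜) (π : ℕ → 𝒮 → 𝒜 → ℝ) :
    (n : ℕ) → ℕ → 𝒮 → (Fin n → 𝒜 × 𝒮) → ℝ
  | 0, _, _, _ => 1
  | n + 1, h, s, τ =>
      π h s (τ 0).1 * M.P h s (τ 0).1 (τ 0).2 * pathProb M π n (h + 1) (τ 0).2 (Fin.tail τ)

/-- The total mean cost `∑ c_{h'}(s_{h'}, a_{h'})` along the path `τ` started at `s_h = s`. -/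
def pathCost (M : MDP 𝒮 𝒜) : (n : ℕ) → ℕ → 𝒮 → (Fin n → 𝒜 × 𝒮) → ℝ
  | 0, _, _, _ => 0
  | n + 1, h, s, τ => M.c h s (τ 0).1 + pathCost M n (h + 1) (τ 0).2 (Fin.tail τ)

/-- The value function `V_h^π(s) = 𝔼[∑_{h' = h}^H c_{h'}(s_{h'}, a_{h'}) | s_h = s, π, P]`. -/
def value (M : MDP 𝒮 𝒜) (H : ℕ) (π : ℕ → 𝒮 → 𝒜 → ℝ) (h : ℕ) (s : 𝒮) : ℝ :=
  ∑ τ : Fin (H + 1 - h) → 𝒜 × 𝒮,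
    pathProb M π (H + 1 - h) h s τ * pathCost M (H + 1 - h) h s τ

/-- The optimal value `V_h^*(s) = min_π V_h^π(s)`. -/
def optValue (M : MDP 𝒮 𝒜) (H : ℕ) (h : ℕ) (s : 𝒮) : ℝ :=
  ⨅ π : Policy 𝒮 𝒜, value M H π.1 h s

end Values

/-! ### The data and the empirical model -/

/-- The observations of one run: state, action and incurred cost, indexed by episode, then step. -/
structure Record (𝒮 𝒜 : Type*) where
  state : ℕ → ℕ → 𝒮
  act : ℕ → ℕ → 𝒜
  cost : ℕ → ℕ → ℝ

section Algorithm

variable {𝒮 𝒜 : Type*} [Fintype 𝒮] [DecidableEq 𝒮] [Fintype 𝒜] [DecidableEq 𝒜]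

/-- `n_h^k(s)`: visits of `s` at step `h` in episodes `1, …, k`. -/
def visits (D : Record 𝒮 𝒜) (k h : ℕ) (s : 𝒮) : ℕ :=
  ((Finset.Icc 1 k).filter fun i => D.state i h = s).card

/-- `n_h^k(s, a)`. -/
def visitsSA (D : Record 𝒮 𝒜) (k h : ℕ) (s : 𝒮) (a : 𝒜) : ℕ :=
  ((Finset.Icc 1 k).filter fun i => D.state i h = s ∧ D.act i h = a).card

/-- `n_h^k(s, a, y)`. -/
def visitsSAS (D : Record 𝒮 𝒜) (k h : ℕ) (s : 𝒮) (a : 𝒜) (y : 𝒮) : ℕ :=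
  ((Finset.Icc 1 k).filter fun i =>
    D.state i h = s ∧ D.act i h = a ∧ D.state i (h + 1) = y).card

/-- `n_h^k(s, a) ∨ 1`, the quantity used in denominators. -/
def cnt (D : Record 𝒮 𝒜) (k h : ℕ) (s : 𝒮) (a : 𝒜) : ℝ :=
  max (visitsSA D k h s a : ℝ) 1

/-- The empirical mean cost (zero for pairs that were not visited). -/
def cbar (D : Record 𝒮 𝒜) (k h : ℕ) (s : 𝒮) (a : 𝒜) : ℝ :=
  (∑ i ∈ (Finset.Icc 1 k).filter (fun i => D.state i h = s ∧ D.act i h = a), D.cost i h) /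
    cnt D k h s a

/-- The empirical transition probabilities (zero for pairs that were not visited). -/
def Pbar (D : Record 𝒮 𝒜) (k h : ℕ) (s : 𝒮) (a : 𝒜) (y : 𝒮) : ℝ :=
  (visitsSAS D k h s a y : ℝ) / cnt D k h s a

/-! ### The bonus -/

/-- The logarithm `ln (m · S A H N / δ')` with `δ' = δ / 5`. -/
def logTerm (𝒮 𝒜 : Type*) [Fintype 𝒮] [Fintype 𝒜] (H : ℕ) (δ m N : ℝ) : ℝ :=
  Real.log (m * Fintype.card 𝒮 * Fintype.card 𝒜 * H * N / (δ / 5))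

/-- The first candidate `u_h^k(s, a)` for the bonus, where `Vref` and `V` are the reference
values and the estimated values at step `h + 1`, and `T = H K`. -/
def uBonus (H K : ℕ) (δ : ℝ) (D : Record 𝒮 𝒜) (Vref V : 𝒮 → ℝ)
    (k h : ℕ) (s : 𝒮) (a : 𝒜) : ℝ :=
  let S : ℝ := Fintype.card 𝒮
  let A : ℝ := Fintype.card 𝒜
  let n : ℝ := cnt D k h s a
  let p : 𝒮 → ℝ := Pbar D k h s a
  let L₂ : ℝ := logTerm 𝒮 𝒜 H δ 2 K
  let LT₂ : ℝ := logTerm 𝒮 𝒜 H δ 2 (H * K)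
  let LT₃ : ℝ := logTerm 𝒮 𝒜 H δ 3 (H * K)
  let variance : ℝ := ∑ y, p y * (Vref y - ∑ z, p z * Vref z) ^ 2
  let term1 : ℝ := √(2 * LT₂ / n)
  let term2 : ℝ := √(6 * variance * L₂ / n) + √(4 * H * L₂ / (S * n))
    + 8 * √(S * H ^ 2) * L₂ / (3 * n)
  let term3 : ℝ := ∑ y,
    (√(2 * p y * (1 - p y) * L₂ / max ((visitsSA D k h s a : ℝ) - 1) 1) + 7 * L₂ / (3 * n))
      * |V y - Vref y|
  let term4 : ℝ := √(4 * H * LT₃ / n) + 7 * S * H * L₂ / (3 * n)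
    + 2 * S ^ (3 / 2 : ℝ) * A ^ (1 / 4 : ℝ) * (H : ℝ) ^ (7 / 4 : ℝ) * (K : ℝ) ^ (1 / 4 : ℝ)
        * √L₂ / n
  term1 + term2 + term3 + term4

/-- The bonus `b_h^k(s, a)`. -/
def bonus (H K : ℕ) (δ : ℝ) (D : Record 𝒮 𝒜) (Vref V : 𝒮 → ℝ)
    (k h : ℕ) (s : 𝒮) (a : 𝒜) : ℝ :=
  min (uBonus H K δ D Vref V k h s a)
    (√(2 * logTerm 𝒮 𝒜 H δ 2 (H * K) / cnt D k h s a)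
      + H * √(4 * Fintype.card 𝒮 * logTerm 𝒮 𝒜 H δ 3 (H * K) / cnt D k h s a))

/-! ### The algorithm -/

/-- What the algorithm stores between episodes: the policy for the next episode, the reference
values, and the value estimates `V_h^i(s)` of the episodes `i` played so far. -/
structure AlgState (𝒮 𝒜 : Type*) where
  pol : ℕ → 𝒮 → 𝒜 → ℝ
  vref : ℕ → 𝒮 → ℝ
  vhist : ℕ → ℕ → 𝒮 → ℝ

/-- `Q_h^k(s, a)` computed from the estimated values `V` at step `h + 1`. -/
def qBackup (H K : ℕ) (δ : ℝ) (D : Record 𝒮 𝒜) (st : AlgState 𝒮 𝒜) (k h : ℕ)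
    (V : 𝒮 → ℝ) (s : 𝒮) (a : 𝒜) : ℝ :=
  max (cbar D k h s a + ∑ y, Pbar D k h s a y * V y
    - bonus H K δ D (st.vref (h + 1)) V k h s a) 0

/-- The estimated values at step `h = H + 1 - j`, by backward recursion from `V_{H+1}^k = 0`. -/
def vBackward (H K : ℕ) (δ : ℝ) (D : Record 𝒮 𝒜) (st : AlgState 𝒮 𝒜) (k : ℕ) :
    ℕ → 𝒮 → ℝ
  | 0, _ => 0
  | j + 1, s => ∑ a, qBackup H K δ D st k (H - j) (vBackward H K δ D st k j) s a
      * st.pol (H - j) s a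

/-- `V_h^k`, given the stored state at the start of episode `k`. -/
def vEst (H K : ℕ) (δ : ℝ) (D : Record 𝒮 𝒜) (st : AlgState 𝒮 𝒜) (k h : ℕ) : 𝒮 → ℝ :=
  vBackward H K δ D st k (H + 1 - h)

/-- `Q_h^k`, given the stored state at the start of episode `k`. -/
def qEst (H K : ℕ) (δ : ℝ) (D : Record 𝒮 𝒜) (st : AlgState 𝒮 𝒜) (k h : ℕ) : 𝒮 → 𝒜 → ℝ :=
  qBackup H K δ D st k h (vEst H K δ D st k (h + 1))

theorem exists_mirror_step [Nonempty 𝒜] (η : ℝ) (q p : 𝒜 → ℝ) :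
    ∃ x ∈ stdSimplex ℝ 𝒜, IsMinOn
      (fun x : 𝒜 → ℝ => η * ∑ a, q a * (x a - p a) + ∑ a, (x a - p a) ^ 2)
      (stdSimplex ℝ 𝒜) x := by
  classical
  refine (isCompact_stdSimplex ℝ 𝒜).exists_isMinOn ?_ (by fun_prop)
  exact ⟨_, single_mem_stdSimplex ℝ (Classical.arbitrary 𝒜)⟩

/-- The policy improvement step
`argmin_{x ∈ Δ(𝒜)} η ⟨q, x - p⟩ + ‖x - p‖₂²` (the minimiser is unique). -/
def mirrorStep [Nonempty 𝒜] (η : ℝ) (q p : 𝒜 → ℝ) : 𝒜 → ℝ :=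
  (exists_mirror_step η q p).choose

/-- `C₀ = √(S³ A H³)`. -/
def C₀ (𝒮 𝒜 : Type*) [Fintype 𝒮] [Fintype 𝒜] (H : ℕ) : ℝ :=
  √((Fintype.card 𝒮 : ℝ) ^ 3 * Fintype.card 𝒜 * (H : ℝ) ^ 3)

/-- Initialisation: uniform policy, zero values. -/
def initState (𝒮 𝒜 : Type*) [Fintype 𝒜] : AlgState 𝒮 𝒜 where
  pol := fun _ _ _ => 1 / (Fintype.card 𝒜 : ℝ)
  vref := fun _ _ => 0
  vhist := fun _ _ _ => 0

/-- The updates at the end of episode `k`. -/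
def algStep [Nonempty 𝒜] (H K : ℕ) (δ : ℝ) (η : ℕ → ℝ) (D : Record 𝒮 𝒜) (k : ℕ)
    (st : AlgState 𝒮 𝒜) : AlgState 𝒮 𝒜 :=
  let vhist' : ℕ → ℕ → 𝒮 → ℝ := Function.update st.vhist k (vEst H K δ D st k)
  { pol := fun h s => mirrorStep (η k) (qEst H K δ D st k h s) (st.pol h s)
    vref := fun h s =>
      if 1 ≤ h ∧ h ≤ H ∧ C₀ 𝒮 𝒜 H * √(k : ℝ) ≤ (visits D k h s : ℝ) then
        (1 / (visits D k h s : ℝ)) *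
          ∑ i ∈ Finset.Icc 1 k, if D.state i h = s then vhist' i h (D.state i h) else 0
      else st.vref h s
    vhist := vhist' }

/-- The stored state after `k` episodes; it depends only on the data of episodes `1, …, k`. -/
def stateAfter [Nonempty 𝒜] (H K : ℕ) (δ : ℝ) (η : ℕ → ℝ) (D : Record 𝒮 𝒜) :
    ℕ → AlgState 𝒮 𝒜
  | 0 => initState 𝒮 𝒜
  | k + 1 => algStep H K δ η D (k + 1) (stateAfter H K δ η D k)

/-- The policy `π^k` played in episode `k ≥ 1`. -/
def polK [Nonempty 𝒜] (H K : ℕ) (δ : ℝ) (η : ℕ → ℝ) (D : Record 𝒮 𝒜) (k : ℕ) :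
    ℕ → 𝒮 → 𝒜 → ℝ :=
  (stateAfter H K δ η D (k - 1)).pol

/-- The estimate `V_h^k`. -/
def VK [Nonempty 𝒜] (H K : ℕ) (δ : ℝ) (η : ℕ → ℝ) (D : Record 𝒮 𝒜) (k h : ℕ) : 𝒮 → ℝ :=
  vEst H K δ D (stateAfter H K δ η D (k - 1)) k h

/-- The estimate `Q_h^k`. -/
def QK [Nonempty 𝒜] (H K : ℕ) (δ : ℝ) (η : ℕ → ℝ) (D : Record 𝒮 𝒜) (k h : ℕ) :
    𝒮 → 𝒜 → ℝ :=
  qEst H K δ D (stateAfter H K δ η D (k - 1)) k h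

/-- The bonus `b_h^k` used in episode `k`. -/
def bK [Nonempty 𝒜] (H K : ℕ) (δ : ℝ) (η : ℕ → ℝ) (D : Record 𝒮 𝒜) (k h : ℕ) :
    𝒮 → 𝒜 → ℝ :=
  bonus H K δ D ((stateAfter H K δ η D (k - 1)).vref (h + 1)) (VK H K δ η D k (h + 1)) k h

/-! ### Interaction with the environment -/

section Interaction

variable {Ω : Type*}

/-- The information before the action of step `h` in episode `k` is taken: all earlier steps
`(i, j)`, with their states, actions, costs and next states, and the current state. -/
@[reducible] def histState (H : ℕ) (X : Ω → Record 𝒮 𝒜) (k h : ℕ) : MeasurableSpace Ω :=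
  (⨆ (i : ℕ) (j : ℕ) (_ : 1 ≤ i ∧ 1 ≤ j ∧ j ≤ H ∧ (i < k ∨ i = k ∧ j < h)),
    MeasurableSpace.comap (fun ω => (X ω).state i j) ⊤ ⊔
    MeasurableSpace.comap (fun ω => (X ω).act i j) ⊤ ⊔
    MeasurableSpace.comap (fun ω => (X ω).cost i j) (borel ℝ) ⊔
    MeasurableSpace.comap (fun ω => (X ω).state i (j + 1)) ⊤) ⊔
  MeasurableSpace.comap (fun ω => (X ω).state k h) ⊤

/-- The information just after the action of step `h` in episode `k`. -/
@[reducible] def histAct (H : ℕ) (X : Ω → Record 𝒮 𝒜) (k h : ℕ) : MeasurableSpace Ω :=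
  histState H X k h ⊔ MeasurableSpace.comap (fun ω => (X ω).act k h) ⊤

/-- The information just after the cost of step `h` in episode `k` is incurred. -/
@[reducible] def histCost (H : ℕ) (X : Ω → Record 𝒮 𝒜) (k h : ℕ) : MeasurableSpace Ω :=
  histAct H X k h ⊔ MeasurableSpace.comap (fun ω => (X ω).cost k h) (borel ℝ)

/-- `X` is the random record of `K` episodes of the algorithm in the MDP `M`, each started at
`s₁`: given the past, the action is drawn from `π_h^k(· | s_h^k)`, then the cost from the cost
law at `(s_h^k, a_h^k)`, then the next state from `P_h(· | s_h^k, a_h^k)`. -/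
structure IsRun [Nonempty 𝒜] [MeasurableSpace Ω] (M : MDP 𝒮 𝒜) (H K : ℕ) (δ : ℝ) (η : ℕ → ℝ)
    (s₁ : 𝒮) (μ : Measure Ω) (X : Ω → Record 𝒮 𝒜) : Prop where
  measurable_state : ∀ k h x, MeasurableSet {ω | (X ω).state k h = x}
  measurable_act : ∀ k h x, MeasurableSet {ω | (X ω).act k h = x}
  measurable_cost : ∀ k h, Measurable fun ω => (X ω).cost k h
  start : ∀ k, 1 ≤ k → k ≤ K → ∀ᵐ ω ∂μ, (X ω).state k 1 = s₁
  act_law : ∀ k h, 1 ≤ k → k ≤ K → 1 ≤ h → h ≤ H → ∀ a : 𝒜,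
    μ[Set.indicator {ω | (X ω).act k h = a} (fun _ => (1 : ℝ)) | histState H X k h]
      =ᵐ[μ] fun ω => polK H K δ η (X ω) k h ((X ω).state k h) a
  cost_law : ∀ k h, 1 ≤ k → k ≤ K → 1 ≤ h → h ≤ H → ∀ B : Set ℝ, MeasurableSet B →
    μ[Set.indicator {ω | (X ω).cost k h ∈ B} (fun _ => (1 : ℝ)) | histAct H X k h]
      =ᵐ[μ] fun ω => (M.costLaw h ((X ω).state k h) ((X ω).act k h)).real B
  state_law : ∀ k h, 1 ≤ k → k ≤ K → 1 ≤ h → h ≤ H → ∀ y : 𝒮,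
    μ[Set.indicator {ω | (X ω).state k (h + 1) = y} (fun _ => (1 : ℝ)) | histCost H X k h]
      =ᵐ[μ] fun ω => M.P h ((X ω).state k h) ((X ω).act k h) y

end Interaction

/-! ### Regret and optimism -/

/-- The `h`-th step regret `∑_{k ≤ K'} (V_h^{π^k}(s_h^k) - V_h^*(s_h^k))` of a run. -/
def regret [Nonempty 𝒜] (M : MDP 𝒮 𝒜) (H K : ℕ) (δ : ℝ) (η : ℕ → ℝ) (D : Record 𝒮 𝒜)
    (h K' : ℕ) : ℝ :=
  ∑ k ∈ Finset.Icc 1 K',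
    (value M H (polK H K δ η D k) h (D.state k h) - optValue M H h (D.state k h))

/-- Optimism: `-2 b_h^k(s,a) ≤ Q_h^k(s,a) - c_h(s,a) - P_h(· | s,a) V_{h+1}^k ≤ 0` for all
`k ≤ K`, `h ≤ H`, `s` and `a`. -/
def Optimism [Nonempty 𝒜] (M : MDP 𝒮 𝒜) (H K : ℕ) (δ : ℝ) (η : ℕ → ℝ)
    (D : Record 𝒮 𝒜) : Prop :=
  ∀ k h, 1 ≤ k → k ≤ K → 1 ≤ h → h ≤ H → ∀ s a,
    -2 * bK H K δ η D k h s a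
        ≤ QK H K δ η D k h s a - M.c h s a - ∑ y, M.P h s a y * VK H K δ η D k (h + 1) y ∧
      QK H K δ η D k h s a - M.c h s a - ∑ y, M.P h s a y * VK H K δ η D k (h + 1) y ≤ 0

end Algorithm

end RPOSAT

end

set_option linter.unusedSectionVars false

noncomputable section

namespace RPOSAT

open MeasureTheory

/-! ### Averages over the simplex -/

section Simplex

variable {ι : Type*} [Fintype ι] {w : ι → ℝ}

/-! Probability enters only through two families of bounded martingale sums; once these are under
control, the argument is deterministic on the event of optimism. Under optimism both `V^k` and `V^*`
lie below the value `V^π` of `π = π^k`, so `|V^k - V^*| ≤ (V^π - V^*) + (V^π - V^k)`. It remains to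
sum the two gaps on the right along the trajectory. Estimation. The lower half of optimism bounds
`V^π - V^k` by the value of the cost `2 b^k` under `π^k` (`value_sub_VK_mem`). Of the bonus only the
second entry of the minimum is used, which is of order `H √S / √n` up to logarithms and free of
reference values. Since `b^k` and `V^k` depend on episode `k` itself, they are replaced by the
predictable `bonusCap` and `width`. The latter is truncated at `H`, so it is bounded even where
optimism fails. Summing `1 / √n` over visits (`sum_inv_sqrt_prior_le`) costs `H √S √(S A n)` per
step, hence `√(S² A H⁴ n)` over at most `H` steps. Optimisation. At one fixed state, mirror descent
bounds `∑_k ⟨Q^k, π^k - π⟩` by order `H √(A n)`. The remainder is an average of the same sums at the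
next step under the fixed kernel of `π`, so backward induction gives `H² √(A n)` with no noise
(`sum_VK_sub_value_le`). This controls step `1`, where the state is always `s₁`. Later steps. The
gap `V^π - V^*` is at least the average of its successor, so the gap at `s_h^k` is the gap at `s₁`
plus noise (`value_sub_optValue_le_sum`). Concentration. An exponential-moment induction
(`IsRun.integral_exp_sum_le`) gives Azuma-Hoeffding tails; a union bound over all steps and prefix
lengths `n ≤ K` makes the estimate valid at any time. -/

theorem simplex_sum_le (hw : w ∈ stdSimplex ℝ ι) {f : ι → ℝ} {b : ℝ} (hf : ∀ i, f i ≤ b) :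
    ∑ i, w i * f i ≤ b :=
  calc ∑ i, w i * f i ≤ ∑ i, w i * b :=
        Finset.sum_le_sum fun i _ => mul_le_mul_of_nonneg_left (hf i) (hw.1 i)
    _ = b := by rw [← Finset.sum_mul, hw.2, one_mul]

theorem le_simplex_sum (hw : w ∈ stdSimplex ℝ ι) {f : ι → ℝ} {b : ℝ} (hf : ∀ i, b ≤ f i) :
    b ≤ ∑ i, w i * f i :=
  calc b = ∑ i, w i * b := by rw [← Finset.sum_mul, hw.2, one_mul]
    _ ≤ ∑ i, w i * f i :=
        Finset.sum_le_sum fun i _ => mul_le_mul_of_nonneg_left (hf i) (hw.1 i)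

theorem simplex_sum_mono (hw : w ∈ stdSimplex ℝ ι) {f g : ι → ℝ} (hfg : ∀ i, f i ≤ g i) :
    ∑ i, w i * f i ≤ ∑ i, w i * g i :=
  Finset.sum_le_sum fun i _ => mul_le_mul_of_nonneg_left (hfg i) (hw.1 i)

theorem simplex_le_one (hw : w ∈ stdSimplex ℝ ι) (i : ι) : w i ≤ 1 := by
  rw [← hw.2]
  exact Finset.single_le_sum (fun j _ => hw.1 j) (Finset.mem_univ i)

theorem simplex_sq_dist_le_two {v : ι → ℝ} (hv : v ∈ stdSimplex ℝ ι) (hw : w ∈ stdSimplex ℝ ι) :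
    ∑ i, (v i - w i) ^ 2 ≤ 2 := by
  calc ∑ i, (v i - w i) ^ 2 ≤ ∑ i, (v i + w i) := by
        refine Finset.sum_le_sum fun i _ => ?_
        nlinarith [hv.1 i, hw.1 i, simplex_le_one hv i, simplex_le_one hw i,
          mul_nonneg (hv.1 i) (hw.1 i)]
    _ = 2 := by rw [Finset.sum_add_distrib, hv.2, hw.2]; norm_num

end Simplex

/-! ### Values -/

section Values

variable {𝒮 𝒜 : Type*} [Fintype 𝒮] [Fintype 𝒜]

theorem sum_fin_cons {α : Type*} [Fintype α] (n : ℕ) (f : (Fin (n + 1) → α) → ℝ) :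
    ∑ τ, f τ = ∑ x, ∑ τ : Fin n → α, f (Fin.cons x τ) := by
  rw [← Fintype.sum_prod_type' (f := fun x τ => f (Fin.cons x τ))]
  exact (Fintype.sum_equiv (Fin.consEquiv fun _ => α) _ _ fun _ => rfl).symm

variable (M : MDP 𝒮 𝒜)

theorem MDP.c_mem (h : ℕ) (s : 𝒮) (a : 𝒜) : 0 ≤ M.c h s a ∧ M.c h s a ≤ 1 := by
  have := M.costLaw_prob h s a
  have hae : ∀ᵐ x ∂(M.costLaw h s a), x ∈ Set.Icc (0 : ℝ) 1 :=
    mem_ae_iff.2 (M.costLaw_support h s a)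
  refine ⟨integral_nonneg_of_ae (hae.mono fun x hx => hx.1), ?_⟩
  calc M.c h s a ≤ ∫ _, (1 : ℝ) ∂(M.costLaw h s a) := by
        refine integral_mono_of_nonneg (hae.mono fun x hx => hx.1) (integrable_const _)
          (hae.mono fun x hx => hx.2)
    _ = 1 := by simp

theorem sum_pathProb {π : ℕ → 𝒮 → 𝒜 → ℝ} (hπ : ∀ h s, π h s ∈ stdSimplex ℝ 𝒜)
    (n h : ℕ) (s : 𝒮) : ∑ τ, pathProb M π n h s τ = 1 := by
  induction n generalizing h s with
  | zero => simp [pathProb]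
  | succ n ih =>
    rw [sum_fin_cons]
    simp only [pathProb, Fin.cons_zero, Fin.tail_cons, ← Finset.mul_sum, ih, mul_one]
    rw [Fintype.sum_prod_type]
    simp only [← Finset.mul_sum, (M.P_mem _ _ _).2, mul_one, (hπ h s).2]

/-- Split off the first action and next state of each path. The immediate cost keeps its full weight
because the remaining path probabilities sum to one. -/
theorem value_bellman {H : ℕ} {π : ℕ → 𝒮 → 𝒜 → ℝ} (hπ : ∀ h s, π h s ∈ stdSimplex ℝ 𝒜)
    {h : ℕ} (hh : h ≤ H) (s : 𝒮) :
    value M H π h s =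
      ∑ a, π h s a * (M.c h s a + ∑ y, M.P h s a y * value M H π (h + 1) y) := by
  obtain ⟨n, rfl⟩ := Nat.exists_eq_add_of_le hh
  unfold value
  rw [show h + n + 1 - h = n + 1 by omega, show h + n + 1 - (h + 1) = n by omega, sum_fin_cons,
    Fintype.sum_prod_type]
  refine Finset.sum_congr rfl fun a _ => ?_
  have hc : M.c h s a = ∑ y, M.P h s a y * M.c h s a := by
    rw [← Finset.sum_mul, (M.P_mem h s a).2, one_mul]
  rw [hc, ← Finset.sum_add_distrib, Finset.mul_sum]
  refine Finset.sum_congr rfl fun y _ => ?_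
  simp only [pathProb, pathCost, Fin.cons_zero, Fin.tail_cons, mul_add, Finset.sum_add_distrib]
  rw [← Finset.sum_mul, ← Finset.mul_sum, sum_pathProb M hπ]
  simp only [Finset.mul_sum, mul_assoc, mul_one]

theorem value_eq_zero {H h : ℕ} (hh : H < h) (π : ℕ → 𝒮 → 𝒜 → ℝ) (s : 𝒮) :
    value M H π h s = 0 := by
  unfold value
  rw [show H + 1 - h = 0 by omega]
  simp [pathCost]

/-- Backward induction on the step. -/
theorem backward_induction {H : ℕ} {p : ℕ → Prop} (top : p (H + 1))
    (step : ∀ h, h ≤ H → p (h + 1) → p h) {h : ℕ} (hh : h ≤ H + 1) : p h :=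
  Nat.decreasingInduction (motive := fun m _ => p m) (fun k hk ih => step k (by omega) ih) top hh

theorem value_mem {H : ℕ} {π : ℕ → 𝒮 → 𝒜 → ℝ} (hπ : ∀ h s, π h s ∈ stdSimplex ℝ 𝒜)
    {h : ℕ} (hh : h ≤ H + 1) : ∀ s, 0 ≤ value M H π h s ∧ value M H π h s ≤ H + 1 - h := by
  refine backward_induction (H := H)
    (p := fun h => ∀ s, 0 ≤ value M H π h s ∧ value M H π h s ≤ H + 1 - h) ?_ ?_ hh
  · intro s
    rw [value_eq_zero M (by omega)]
    simp
  · intro h hh ih s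
    rw [value_bellman M hπ hh]
    refine ⟨le_simplex_sum (hπ h s) fun a => add_nonneg (M.c_mem h s a).1
      (le_simplex_sum (M.P_mem h s a) fun y => (ih y).1),
      simplex_sum_le (hπ h s) fun a => ?_⟩
    have := simplex_sum_le (M.P_mem h s a) fun y => (ih y).2
    push_cast at this
    linarith [(M.c_mem h s a).2]

/-- The optimal value at step `H + 1 - j` from the Bellman optimality recursion. -/
def dpBackward (M : MDP 𝒮 𝒜) (H : ℕ) : ℕ → 𝒮 → ℝ
  | 0, _ => 0
  | j + 1, s => ⨅ a, (M.c (H - j) s a + ∑ y, M.P (H - j) s a y * dpBackward M H j y)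

/-- The optimal value from the Bellman optimality recursion. -/
def dpValue (M : MDP 𝒮 𝒜) (H h : ℕ) : 𝒮 → ℝ := dpBackward M H (H + 1 - h)

theorem dpValue_bellman {H h : ℕ} (hh : h ≤ H) (s : 𝒮) :
    dpValue M H h s = ⨅ a, (M.c h s a + ∑ y, M.P h s a y * dpValue M H (h + 1) y) := by
  obtain ⟨n, rfl⟩ := Nat.exists_eq_add_of_le hh
  unfold dpValue
  rw [show h + n + 1 - h = n + 1 by omega, show h + n + 1 - (h + 1) = n by omega, dpBackward,
    show h + n - n = h by omega]

theorem dpValue_top (H : ℕ) (s : 𝒮) : dpValue M H (H + 1) s = 0 := by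
  unfold dpValue
  rw [Nat.sub_self, dpBackward]

theorem dpValue_le_value {H : ℕ} {π : ℕ → 𝒮 → 𝒜 → ℝ} (hπ : ∀ h s, π h s ∈ stdSimplex ℝ 𝒜)
    {h : ℕ} (hh : h ≤ H + 1) : ∀ s, dpValue M H h s ≤ value M H π h s := by
  refine backward_induction (H := H)
    (p := fun h => ∀ s, dpValue M H h s ≤ value M H π h s) ?_ ?_ hh
  · intro s
    rw [dpValue_top, value_eq_zero M (by omega)]
  · intro h hh ih s
    rw [dpValue_bellman M hh, value_bellman M hπ hh]
    refine le_simplex_sum (hπ h s) fun a => (ciInf_le (Set.finite_range _).bddBelow a).trans ?_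
    exact add_le_add_right (simplex_sum_mono (M.P_mem h s a) ih) _

/-- The greedy deterministic policy of the optimality recursion is optimal at all steps and states
simultaneously. A single comparator of this kind is what the mirror descent analysis needs. -/
theorem exists_value_eq_dpValue [Nonempty 𝒜] (H : ℕ) :
    ∃ π : Policy 𝒮 𝒜, ∀ h, h ≤ H + 1 → ∀ s, value M H π.1 h s = dpValue M H h s := by
  classical
  have hex : ∀ h s, ∃ a, M.c h s a + ∑ y, M.P h s a y * dpValue M H (h + 1) y =
      ⨅ a, (M.c h s a + ∑ y, M.P h s a y * dpValue M H (h + 1) y) := fun h s =>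
    exists_eq_ciInf_of_finite
  choose g hg using hex
  have hmem : ∀ h s, (Pi.single (g h s) 1 : 𝒜 → ℝ) ∈ stdSimplex ℝ 𝒜 := fun h s =>
    single_mem_stdSimplex ℝ (g h s)
  refine ⟨⟨fun h s => Pi.single (g h s) 1, hmem⟩, fun h hh => ?_⟩
  refine backward_induction (H := H) (p := fun h => ∀ s, value M H
    (fun h s => Pi.single (g h s) 1) h s = dpValue M H h s) ?_ ?_ hh
  · intro s
    rw [dpValue_top, value_eq_zero M (by omega)]
  · intro h hh ih s
    rw [value_bellman M hmem hh, dpValue_bellman M hh, ← hg h s]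
    simp [Pi.single_apply, ih]

theorem optValue_eq_dpValue [Nonempty 𝒜] {H h : ℕ} (hh : h ≤ H + 1) (s : 𝒮) :
    optValue M H h s = dpValue M H h s := by
  obtain ⟨π, hπ⟩ := exists_value_eq_dpValue M H
  refine le_antisymm ?_ ?_
  · rw [← hπ h hh s]
    refine ciInf_le ⟨0, ?_⟩ π
    rintro _ ⟨σ, rfl⟩
    exact (value_mem M σ.2 hh s).1
  · have : Nonempty (Policy 𝒮 𝒜) := ⟨π⟩
    exact le_ciInf fun σ => dpValue_le_value M σ.2 hh s

theorem optValue_le_value [Nonempty 𝒜] {H : ℕ} {π : ℕ → 𝒮 → 𝒜 → ℝ}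
    (hπ : ∀ h s, π h s ∈ stdSimplex ℝ 𝒜) {h : ℕ} (hh : h ≤ H + 1) (s : 𝒮) :
    optValue M H h s ≤ value M H π h s := by
  rw [optValue_eq_dpValue M hh]
  exact dpValue_le_value M hπ hh s

theorem exists_value_eq_optValue [Nonempty 𝒜] (H : ℕ) :
    ∃ π : Policy 𝒮 𝒜, ∀ h, h ≤ H + 1 → ∀ s, value M H π.1 h s = optValue M H h s := by
  obtain ⟨π, hπ⟩ := exists_value_eq_dpValue M H
  exact ⟨π, fun h hh s => by rw [hπ h hh, optValue_eq_dpValue M hh]⟩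

theorem optValue_nonneg [Nonempty 𝒜] {H h : ℕ} (hh : h ≤ H + 1) (s : 𝒮) :
    0 ≤ optValue M H h s := by
  obtain ⟨π, hπ⟩ := exists_value_eq_optValue M H
  rw [← hπ h hh]
  exact (value_mem M π.2 hh s).1

theorem optValue_le_average [Nonempty 𝒜] {H h : ℕ} (hh : h ≤ H) (s : 𝒮) {p : 𝒜 → ℝ}
    (hp : p ∈ stdSimplex ℝ 𝒜) :
    optValue M H h s ≤ ∑ a, p a * (M.c h s a + ∑ y, M.P h s a y * optValue M H (h + 1) y) := by
  simp only [optValue_eq_dpValue M (show h + 1 ≤ H + 1 by omega),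
    optValue_eq_dpValue M (show h ≤ H + 1 by omega), dpValue_bellman M hh s]
  exact le_simplex_sum hp fun a => ciInf_le (Set.finite_range _).bddBelow a

end Values

/-! ### The mirror step -/

section Mirror

variable {𝒜 : Type*} [Fintype 𝒜] [DecidableEq 𝒜] [Nonempty 𝒜]

theorem mirrorStep_mem (η : ℝ) (q p : 𝒜 → ℝ) : mirrorStep η q p ∈ stdSimplex ℝ 𝒜 :=
  (exists_mirror_step η q p).choose_spec.1

theorem mirrorStep_isMinOn (η : ℝ) (q p : 𝒜 → ℝ) : IsMinOn
    (fun x : 𝒜 → ℝ => η * ∑ a, q a * (x a - p a) + ∑ a, (x a - p a) ^ 2)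
      (stdSimplex ℝ 𝒜) (mirrorStep η q p) :=
  (exists_mirror_step η q p).choose_spec.2

/-- First-order optimality: moving from the minimiser towards `z` by a fraction `t` changes the
objective by `t I + t² N`, which cannot be negative for `t` in `[0, 1]`. -/
theorem mirrorStep_variational (η : ℝ) (q p : 𝒜 → ℝ) {z : 𝒜 → ℝ} (hz : z ∈ stdSimplex ℝ 𝒜) :
    0 ≤ ∑ a, (η * q a + 2 * (mirrorStep η q p a - p a)) * (z a - mirrorStep η q p a) := by
  set x := mirrorStep η q p with hx
  set I := ∑ a, (η * q a + 2 * (x a - p a)) * (z a - x a) with hI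
  set N := ∑ a, (z a - x a) ^ 2 with hN
  have hN0 : 0 ≤ N := Finset.sum_nonneg fun a _ => sq_nonneg _
  have key : ∀ t : ℝ, 0 ≤ t → t ≤ 1 → 0 ≤ t * I + t ^ 2 * N := by
    intro t ht0 ht1
    have hmem : (fun a => (1 - t) * x a + t * z a) ∈ stdSimplex ℝ 𝒜 :=
      convex_stdSimplex ℝ 𝒜 (mirrorStep_mem η q p) hz (by linarith) ht0 (by ring)
    have h := mirrorStep_isMinOn η q p hmem
    simp only [Set.mem_ofPred_eq] at h
    rw [← hx] at h
    have e : η * ∑ a, q a * ((1 - t) * x a + t * z a - p a)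
        + ∑ a, ((1 - t) * x a + t * z a - p a) ^ 2
        = η * ∑ a, q a * (x a - p a) + ∑ a, (x a - p a) ^ 2 + (t * I + t ^ 2 * N) := by
      rw [hI, hN]
      simp only [Finset.mul_sum, ← Finset.sum_add_distrib]
      exact Finset.sum_congr rfl fun a _ => by ring
    linarith
  by_contra hneg
  push Not at hneg
  -- For `I < 0` this fraction lies in `(0, 1]` and makes `I + t N = -I² / (N - I)`, which is
  -- negative.
  have ht : 0 < -I / (N - I) := div_pos (by linarith) (by linarith)
  have ht1 : -I / (N - I) ≤ 1 := (div_le_one (by linarith)).2 (by linarith)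
  have h := key _ ht.le ht1
  have h2 : 0 ≤ I + (-I / (N - I)) * N := by
    by_contra hc
    push Not at hc
    nlinarith
  have h3 : I + (-I / (N - I)) * N = -I ^ 2 / (N - I) := by
    have : N - I ≠ 0 := by linarith
    field_simp
    ring
  rw [h3, le_div_iff₀ (by linarith)] at h2
  nlinarith [sq_nonneg I, mul_pos_of_neg_of_neg hneg hneg]

/-- One step of online mirror descent. -/
theorem mirrorStep_descent (η : ℝ) (q p : 𝒜 → ℝ) {z : 𝒜 → ℝ} (hz : z ∈ stdSimplex ℝ 𝒜) :
    η * ∑ a, q a * (p a - z a) ≤ ∑ a, (z a - p a) ^ 2 - ∑ a, (z a - mirrorStep η q p a) ^ 2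
      + η ^ 2 * ∑ a, q a ^ 2 := by
  have h := mirrorStep_variational η q p hz
  set x := mirrorStep η q p
  -- Three-point identity: after the variational inequality is used, the slack is a sum of squares.
  have e : ∑ a, (z a - p a) ^ 2 - ∑ a, (z a - x a) ^ 2 + η ^ 2 * ∑ a, q a ^ 2
      - η * ∑ a, q a * (p a - z a) - ∑ a, (η * q a + 2 * (x a - p a)) * (z a - x a)
      = ∑ a, ((x a - p a + η * q a / 2) ^ 2 + 3 / 4 * (η * q a) ^ 2) := by
    simp only [Finset.mul_sum, ← Finset.sum_add_distrib, ← Finset.sum_sub_distrib]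
    exact Finset.sum_congr rfl fun a _ => by ring
  have : 0 ≤ ∑ a, ((x a - p a + η * q a / 2) ^ 2 + 3 / 4 * (η * q a) ^ 2) :=
    Finset.sum_nonneg fun a _ => by positivity
  linarith

/-- The mirror step is nonexpansive in the point `p - η q / 2` that it projects. -/
theorem mirrorStep_nonexpansive (η : ℝ) (q p q' p' : 𝒜 → ℝ) :
    ∑ a, (mirrorStep η q p a - mirrorStep η q' p' a) ^ 2
      ≤ ∑ a, ((p a - η * q a / 2) - (p' a - η * q' a / 2)) ^ 2 := by
  have h := mirrorStep_variational η q p (mirrorStep_mem η q' p')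
  have h' := mirrorStep_variational η q' p' (mirrorStep_mem η q p)
  set x := mirrorStep η q p
  set x' := mirrorStep η q' p'
  -- The usual proof for projections: each variational inequality is tested at the other minimiser,
  -- and what is left over is a square.
  have e : ∑ a, ((p a - η * q a / 2) - (p' a - η * q' a / 2)) ^ 2 - ∑ a, (x a - x' a) ^ 2
      = ∑ a, ((p a - η * q a / 2) - (p' a - η * q' a / 2) - (x a - x' a)) ^ 2
        + ∑ a, (η * q a + 2 * (x a - p a)) * (x' a - x a)
        + ∑ a, (η * q' a + 2 * (x' a - p' a)) * (x a - x' a) := by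
    simp only [← Finset.sum_add_distrib, ← Finset.sum_sub_distrib]
    exact Finset.sum_congr rfl fun a _ => by ring
  have : 0 ≤ ∑ a, ((p a - η * q a / 2) - (p' a - η * q' a / 2) - (x a - x' a)) ^ 2 :=
    Finset.sum_nonneg fun a _ => sq_nonneg _
  linarith

/-- The minimiser is picked by `choose`, so its measurable dependence on the data needs a proof;
nonexpansiveness supplies it through continuity. -/
theorem continuous_mirrorStep (η : ℝ) :
    Continuous fun z : (𝒜 → ℝ) × (𝒜 → ℝ) => mirrorStep η z.1 z.2 := by
  refine continuous_iff_continuousAt.2 fun z₀ => ?_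
  refine tendsto_pi_nhds.2 fun a => tendsto_iff_dist_tendsto_zero.2 ?_
  set F : (𝒜 → ℝ) × (𝒜 → ℝ) → ℝ := fun z =>
    √(∑ a, ((z.2 a - η * z.1 a / 2) - (z₀.2 a - η * z₀.1 a / 2)) ^ 2) with hF
  have hcont : Continuous F := by fun_prop
  have h0 : Filter.Tendsto F (nhds z₀) (nhds 0) := by
    have := hcont.tendsto z₀
    simpa [hF] using this
  refine squeeze_zero (fun _ => dist_nonneg) (fun z => ?_) h0
  rw [Real.dist_eq]
  refine Real.abs_le_sqrt (le_trans ?_ (mirrorStep_nonexpansive η z.1 z.2 z₀.1 z₀.2))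
  exact Finset.single_le_sum
    (f := fun a => (mirrorStep η z.1 z.2 a - mirrorStep η z₀.1 z₀.2 a) ^ 2)
    (fun _ _ => sq_nonneg _) (Finset.mem_univ a)

/-- The regret of online mirror descent with nonincreasing step sizes. -/
theorem mirror_regret {η : ℕ → ℝ} {q p : ℕ → 𝒜 → ℝ} {z : 𝒜 → ℝ} {b : ℝ} {K : ℕ}
    (hη : ∀ k, 1 ≤ k → k ≤ K → 0 < η k) (hanti : ∀ k, 1 ≤ k → k < K → η (k + 1) ≤ η k)
    (hz : z ∈ stdSimplex ℝ 𝒜) (hp : ∀ k, p k ∈ stdSimplex ℝ 𝒜)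
    (hstep : ∀ k, 1 ≤ k → p (k + 1) = mirrorStep (η k) (q k) (p k))
    (hq : ∀ k, 1 ≤ k → k ≤ K → ∑ a, q k a ^ 2 ≤ b) {n : ℕ} (hn : 1 ≤ n) (hnK : n ≤ K) :
    ∑ k ∈ Finset.Icc 1 n, ∑ a, q k a * (p k a - z a)
      ≤ 2 / η n + b * ∑ k ∈ Finset.Icc 1 n, η k := by
  have one : ∀ k, 1 ≤ k → k ≤ K → ∑ a, q k a * (p k a - z a) ≤
      (∑ a, (z a - p k a) ^ 2) / η k - (∑ a, (z a - p (k + 1) a) ^ 2) / η k + b * η k := by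
    intro k hk hkK
    have h0 := hη k hk hkK
    have h := mirrorStep_descent (η k) (q k) (p k) hz
    rw [← hstep k hk] at h
    have h2 : η k ^ 2 * ∑ a, q k a ^ 2 ≤ η k ^ 2 * b :=
      mul_le_mul_of_nonneg_left (hq k hk hkK) (sq_nonneg _)
    rw [← sub_div, ← sub_le_iff_le_add, le_div_iff₀ h0]
    nlinarith
  -- The final potential, which could be discarded, is kept so that the induction telescopes.
  suffices hs : ∑ k ∈ Finset.Icc 1 n, ∑ a, q k a * (p k a - z a)
      + (∑ a, (z a - p (n + 1) a) ^ 2) / η n ≤ 2 / η n + b * ∑ k ∈ Finset.Icc 1 n, η k by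
    have : 0 ≤ (∑ a, (z a - p (n + 1) a) ^ 2) / η n :=
      div_nonneg (Finset.sum_nonneg fun _ _ => sq_nonneg _) (hη n hn hnK).le
    linarith
  induction n, hn using Nat.le_induction with
  | base =>
    have h1 := one 1 le_rfl hnK
    have h2 : (∑ a, (z a - p 1 a) ^ 2) / η 1 ≤ 2 / η 1 :=
      div_le_div_of_nonneg_right (simplex_sq_dist_le_two hz (hp 1)) (hη 1 le_rfl hnK).le
    simp only [Finset.Icc_self, Finset.sum_singleton]
    linarith
  | succ n hn ih =>
    have ih := ih (by omega)
    have h1 := one (n + 1) (by omega) hnK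
    rw [Finset.sum_Icc_succ_top (by omega), Finset.sum_Icc_succ_top (by omega)]
    -- Summation by parts: `1 / η` is nondecreasing and the potential is at most `2`, so the changes
    -- of weight add up to at most `2 / η n`.
    have hinv : 1 / η n ≤ 1 / η (n + 1) :=
      one_div_le_one_div_of_le (hη _ (by omega) hnK) (hanti n hn (by omega))
    have h2 := simplex_sq_dist_le_two hz (hp (n + 1))
    have h3 : 0 ≤ (2 - ∑ a, (z a - p (n + 1) a) ^ 2) * (1 / η (n + 1) - 1 / η n) :=
      mul_nonneg (by linarith) (by linarith)
    have h4 : (2 - ∑ a, (z a - p (n + 1) a) ^ 2) * (1 / η (n + 1) - 1 / η n)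
      = 2 / η (n + 1) - 2 / η n - (∑ a, (z a - p (n + 1) a) ^ 2) / η (n + 1)
        + (∑ a, (z a - p (n + 1) a) ^ 2) / η n := by ring
    linarith

end Mirror

/-! ### Counting visits -/

/-- Makes the sum over visits telescope. For `m ≥ 1` the factor `3` comes from `√(m + 1) + √m ≤ 3
√m`, and for `m = 0` there is room to spare. -/
theorem inv_sqrt_max_le (m : ℕ) : 1 / √(max (m : ℝ) 1) ≤ 3 * (√((m : ℝ) + 1) - √m) := by
  rcases Nat.eq_zero_or_pos m with rfl | hm
  · norm_num
  · have hm1 : (1 : ℝ) ≤ m := by exact_mod_cast hm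
    rw [max_eq_left hm1]
    have h0 : 0 < √(m : ℝ) := Real.sqrt_pos.2 (by linarith)
    have hsq : √(m : ℝ) ^ 2 = m := Real.sq_sqrt (by linarith)
    have hsq' : √((m : ℝ) + 1) ^ 2 = m + 1 := Real.sq_sqrt (by linarith)
    have hlow : √(m : ℝ) ≤ √((m : ℝ) + 1) := Real.sqrt_le_sqrt (by linarith)
    have hup : √((m : ℝ) + 1) ≤ 2 * √m := by
      rw [Real.sqrt_le_left (by positivity)]
      nlinarith
    rw [div_le_iff₀ h0]
    nlinarith [mul_nonneg (sub_nonneg.2 hlow) (sub_nonneg.2 hup)]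

/-- Grouped by value, the terms telescope to the square roots of the final counts. These counts sum
to `n`, so Cauchy-Schwarz finishes. Counting only earlier indices matches a predictable bonus. -/
theorem sum_inv_sqrt_prior_le {α : Type*} [Fintype α] [DecidableEq α] (x : ℕ → α) (n : ℕ) :
    ∑ k ∈ Finset.Icc 1 n,
        1 / √(max ((((Finset.Icc 1 (k - 1)).filter fun i => x i = x k).card : ℕ) : ℝ) 1)
      ≤ 3 * √(Fintype.card α * n) := by
  have key : ∑ k ∈ Finset.Icc 1 n,
        1 / √(max ((((Finset.Icc 1 (k - 1)).filter fun i => x i = x k).card : ℕ) : ℝ) 1)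
      ≤ 3 * ∑ a, √((((Finset.Icc 1 n).filter fun i => x i = a).card : ℕ) : ℝ) := by
    induction n with
    | zero => simp
    | succ n ih =>
      rw [Finset.sum_Icc_succ_top (by omega), Nat.add_sub_cancel]
      have hstep := inv_sqrt_max_le ((Finset.Icc 1 n).filter fun i => x i = x (n + 1)).card
      have hcard : ∀ a, ((Finset.Icc 1 (n + 1)).filter fun i => x i = a).card
          = ((Finset.Icc 1 n).filter fun i => x i = a).card
            + if x (n + 1) = a then 1 else 0 := by
        intro a
        rw [Finset.card_filter, Finset.sum_Icc_succ_top (by omega), ← Finset.card_filter]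
      have hsum : ∑ a, √((((Finset.Icc 1 (n + 1)).filter fun i => x i = a).card : ℕ) : ℝ)
          = ∑ a, √((((Finset.Icc 1 n).filter fun i => x i = a).card : ℕ) : ℝ)
            + (√((((Finset.Icc 1 n).filter fun i => x i = x (n + 1)).card : ℕ) + 1 : ℝ)
              - √((((Finset.Icc 1 n).filter fun i => x i = x (n + 1)).card : ℕ) : ℝ)) := by
        rw [← sub_eq_iff_eq_add', ← Finset.sum_sub_distrib, Finset.sum_eq_single (x (n + 1))]
        · rw [hcard, if_pos rfl]
          push_cast
          rfl
        · intro a _ ha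
          rw [hcard, if_neg (Ne.symm ha), add_zero, sub_self]
        · intro h
          exact absurd (Finset.mem_univ _) h
      rw [hsum]
      linarith
  refine key.trans (mul_le_mul_of_nonneg_left ?_ (by norm_num))
  refine Real.le_sqrt_of_sq_le ?_
  refine (sq_sum_le_card_mul_sum_sq (s := Finset.univ)).trans ?_
  rw [Finset.card_univ]
  refine mul_le_mul_of_nonneg_left (le_of_eq ?_) (Nat.cast_nonneg _)
  simp only [Real.sq_sqrt (Nat.cast_nonneg _)]
  rw [← Nat.cast_sum, Finset.sum_card_fiberwise_eq_card_filter]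
  simp

theorem sum_inv_sqrt_le (n : ℕ) : ∑ k ∈ Finset.Icc 1 n, 1 / √(k : ℝ) ≤ 2 * √n := by
  induction n with
  | zero => simp
  | succ n ih =>
    rw [Finset.sum_Icc_succ_top (by omega)]
    have h0 : 0 < √((n + 1 : ℕ) : ℝ) := Real.sqrt_pos.2 (by positivity)
    have hsq : √((n + 1 : ℕ) : ℝ) ^ 2 = n + 1 := by
      rw [Real.sq_sqrt (by positivity)]
      push_cast
      ring
    have hsq' : √(n : ℝ) ^ 2 = n := Real.sq_sqrt (by positivity)
    have h1 : 1 / √((n + 1 : ℕ) : ℝ) ≤ 2 * (√((n + 1 : ℕ) : ℝ) - √n) := by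
      rw [div_le_iff₀ h0]
      nlinarith [sq_nonneg (√((n + 1 : ℕ) : ℝ) - √n)]
    linarith

/-! ### One step of the environment -/

section Algorithm

variable {𝒮 𝒜 : Type*} [Fintype 𝒮] [DecidableEq 𝒮] [Fintype 𝒜] [DecidableEq 𝒜]

/-- The average of `g a y` over the action `a` at `s` and the next state `y`. -/
def stepAvg (M : MDP 𝒮 𝒜) (π : ℕ → 𝒮 → 𝒜 → ℝ) (h : ℕ) (s : 𝒮) (g : 𝒜 → 𝒮 → ℝ) : ℝ :=
  ∑ a, π h s a * ∑ y, M.P h s a y * g a y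

theorem stepAvg_le {M : MDP 𝒮 𝒜} {π : ℕ → 𝒮 → 𝒜 → ℝ} {h : ℕ} {s : 𝒮}
    (hπ : π h s ∈ stdSimplex ℝ 𝒜) {g : 𝒜 → 𝒮 → ℝ} {b : ℝ} (hg : ∀ a y, g a y ≤ b) :
    stepAvg M π h s g ≤ b :=
  simplex_sum_le hπ fun a => simplex_sum_le (M.P_mem h s a) (hg a)

theorem le_stepAvg {M : MDP 𝒮 𝒜} {π : ℕ → 𝒮 → 𝒜 → ℝ} {h : ℕ} {s : 𝒮}
    (hπ : π h s ∈ stdSimplex ℝ 𝒜) {g : 𝒜 → 𝒮 → ℝ} {b : ℝ} (hg : ∀ a y, b ≤ g a y) :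
    b ≤ stepAvg M π h s g :=
  le_simplex_sum hπ fun a => le_simplex_sum (M.P_mem h s a) (hg a)

theorem stepAvg_neg (M : MDP 𝒮 𝒜) (π : ℕ → 𝒮 → 𝒜 → ℝ) (h : ℕ) (s : 𝒮) (g : 𝒜 → 𝒮 → ℝ) :
    stepAvg M π h s (fun a y => -g a y) = -stepAvg M π h s g := by
  simp [stepAvg]

/-- The values of the policy `π` in the MDP with costs `2 B`, truncated at `H`, at step
`H + 1 - j`. -/
def widthBackward (M : MDP 𝒮 𝒜) (H : ℕ) (π B : ℕ → 𝒮 → 𝒜 → ℝ) : ℕ → 𝒮 → ℝ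
  | 0, _ => 0
  | j + 1, s => min (H : ℝ)
      (stepAvg M π (H - j) s fun a y => 2 * B (H - j) s a + widthBackward M H π B j y)

/-- The values of the policy `π` in the MDP with costs `2 B`, truncated at `H`. -/
def width (M : MDP 𝒮 𝒜) (H : ℕ) (π B : ℕ → 𝒮 → 𝒜 → ℝ) (h : ℕ) : 𝒮 → ℝ :=
  widthBackward M H π B (H + 1 - h)

theorem width_top (M : MDP 𝒮 𝒜) (H : ℕ) (π B : ℕ → 𝒮 → 𝒜 → ℝ) (s : 𝒮) :
    width M H π B (H + 1) s = 0 := by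
  rw [width, Nat.sub_self, widthBackward]

theorem width_eq (M : MDP 𝒮 𝒜) {H h : ℕ} (hh : h ≤ H) (π B : ℕ → 𝒮 → 𝒜 → ℝ) (s : 𝒮) :
    width M H π B h s = min (H : ℝ)
      (stepAvg M π h s fun a y => 2 * B h s a + width M H π B (h + 1) y) := by
  obtain ⟨n, rfl⟩ := Nat.exists_eq_add_of_le hh
  unfold width
  rw [show h + n + 1 - h = n + 1 by omega, show h + n + 1 - (h + 1) = n by omega, widthBackward,
    show h + n - n = h by omega]

theorem width_mem (M : MDP 𝒮 𝒜) {H h : ℕ} (hh : h ≤ H + 1) {π B : ℕ → 𝒮 → 𝒜 → ℝ}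
    (hπ : ∀ h s, π h s ∈ stdSimplex ℝ 𝒜) (hB : ∀ h s a, 0 ≤ B h s a) :
    ∀ s, 0 ≤ width M H π B h s ∧ width M H π B h s ≤ H := by
  refine backward_induction (H := H)
    (p := fun h => ∀ s, 0 ≤ width M H π B h s ∧ width M H π B h s ≤ H) ?_ ?_ hh
  · intro s
    rw [width_top]
    exact ⟨le_rfl, Nat.cast_nonneg _⟩
  · intro h hh ih s
    rw [width_eq M hh]
    refine ⟨le_min (Nat.cast_nonneg _) (le_stepAvg (hπ h s) fun a y => ?_), min_le_left _ _⟩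
    linarith [hB h s a, (ih y).1]

variable [Nonempty 𝒜] (M : MDP 𝒮 𝒜) (H K : ℕ) (δ : ℝ) (η : ℕ → ℝ) (D : Record 𝒮 𝒜)

/-! ### The iterates of the algorithm -/

theorem polK_mem (k h : ℕ) (s : 𝒮) : polK H K δ η D k h s ∈ stdSimplex ℝ 𝒜 := by
  unfold polK
  cases k - 1 with
  | zero =>
    refine ⟨fun a => ?_, ?_⟩
    · simp only [stateAfter, initState]
      positivity
    · simp [stateAfter, initState]
  | succ n => exact mirrorStep_mem _ _ _

theorem polK_succ {k : ℕ} (hk : 1 ≤ k) (h : ℕ) (s : 𝒮) :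
    polK H K δ η D (k + 1) h s
      = mirrorStep (η k) (QK H K δ η D k h s) (polK H K δ η D k h s) := by
  obtain ⟨k, rfl⟩ := Nat.exists_eq_add_of_le' hk
  rfl

theorem QK_nonneg (k h : ℕ) (s : 𝒮) (a : 𝒜) : 0 ≤ QK H K δ η D k h s a := le_max_right _ _

theorem VK_top (k : ℕ) (s : 𝒮) : VK H K δ η D k (H + 1) s = 0 := by
  rw [VK, vEst, Nat.sub_self, vBackward]

theorem VK_eq {h : ℕ} (hh : h ≤ H) (k : ℕ) (s : 𝒮) :
    VK H K δ η D k h s = ∑ a, polK H K δ η D k h s a * QK H K δ η D k h s a := by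
  obtain ⟨n, rfl⟩ := Nat.exists_eq_add_of_le hh
  unfold VK QK qEst vEst
  rw [show h + n + 1 - h = n + 1 by omega, show h + n + 1 - (h + 1) = n by omega, vBackward,
    show h + n - n = h by omega]
  exact Finset.sum_congr rfl fun a _ => mul_comm _ _

theorem VK_nonneg {h : ℕ} (hh : h ≤ H + 1) (k : ℕ) (s : 𝒮) : 0 ≤ VK H K δ η D k h s := by
  rcases Nat.lt_or_ge H h with h1 | h1
  · obtain rfl : h = H + 1 := by omega
    rw [VK_top]
  · rw [VK_eq H K δ η D h1]
    exact le_simplex_sum (polK_mem H K δ η D k h s) fun a => QK_nonneg H K δ η D k h s a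

variable {M H K δ η D}

/-- The algorithm truncates `Q` only from below; the upper bound comes from the half `Q ≤ c + P V`
of optimism. -/
theorem VK_le_of_optimism (hopt : Optimism M H K δ η D) {k : ℕ} (hk : 1 ≤ k) (hkK : k ≤ K)
    {h : ℕ} (hh : h ≤ H + 1) :
    1 ≤ h → ∀ s, VK H K δ η D k h s ≤ H + 1 - h := by
  refine backward_induction (H := H)
    (p := fun h => 1 ≤ h → ∀ s, VK H K δ η D k h s ≤ H + 1 - h) ?_ ?_ hh
  · intro _ s
    rw [VK_top]
    simp
  · intro h hh ih h1 s
    rw [VK_eq H K δ η D hh]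
    refine simplex_sum_le (polK_mem H K δ η D k h s) fun a => ?_
    have h2 := (hopt k h hk hkK h1 hh s a).2
    have h3 := simplex_sum_le (M.P_mem h s a) (ih (by omega))
    push_cast at h3
    linarith [(M.c_mem h s a).2]

theorem QK_le_of_optimism (hopt : Optimism M H K δ η D) {k : ℕ} (hk : 1 ≤ k) (hkK : k ≤ K)
    {h : ℕ} (hh : h ≤ H) (h1 : 1 ≤ h) (s : 𝒮) (a : 𝒜) : QK H K δ η D k h s a ≤ H := by
  have h2 := (hopt k h hk hkK h1 hh s a).2
  have h3 := simplex_sum_le (M.P_mem h s a)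
    (VK_le_of_optimism hopt hk hkK (show h + 1 ≤ H + 1 by omega) (by omega))
  have h4 : (1 : ℝ) ≤ h := by exact_mod_cast h1
  push_cast at h3
  linarith [(M.c_mem h s a).2]

/-- Under optimism the estimates are below the values of the policy played, and the difference is
at most the truncated sum of bonuses. -/
theorem value_sub_VK_mem (hopt : Optimism M H K δ η D) {k : ℕ} (hk : 1 ≤ k) (hkK : k ≤ K)
    {B : ℕ → 𝒮 → 𝒜 → ℝ}
    (hB : ∀ h, 1 ≤ h → h ≤ H → ∀ s a, bK H K δ η D k h s a ≤ B h s a)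
    (hB0 : ∀ h s a, 0 ≤ B h s a) {h : ℕ} (hh : h ≤ H + 1) :
    1 ≤ h → ∀ s, 0 ≤ value M H (polK H K δ η D k) h s - VK H K δ η D k h s ∧
      value M H (polK H K δ η D k) h s - VK H K δ η D k h s
        ≤ width M H (polK H K δ η D k) (fun h s a => min (B h s a) H) h s := by
  have hπ := polK_mem H K δ η D k
  refine backward_induction (H := H)
    (p := fun h => 1 ≤ h → ∀ s, 0 ≤ value M H (polK H K δ η D k) h s - VK H K δ η D k h s ∧
      value M H (polK H K δ η D k) h s - VK H K δ η D k h s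
        ≤ width M H (polK H K δ η D k) (fun h s a => min (B h s a) H) h s) ?_ ?_ hh
  · intro _ s
    rw [VK_top, value_eq_zero M (by omega), width_top]
    simp
  · intro h hh ih h1 s
    have ih := ih (by omega)
    have hval := value_mem M hπ (show h ≤ H + 1 by omega) s
    have hval' := value_mem M hπ (show h + 1 ≤ H + 1 by omega)
    have hV := VK_nonneg H K δ η D (show h ≤ H + 1 by omega) k s
    have h1' : (1 : ℝ) ≤ h := by exact_mod_cast h1
    have hdiff : value M H (polK H K δ η D k) h s - VK H K δ η D k h s
        = ∑ a, polK H K δ η D k h s a * (M.c h s a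
          + ∑ y, M.P h s a y * value M H (polK H K δ η D k) (h + 1) y - QK H K δ η D k h s a) := by
      rw [value_bellman M hπ hh, VK_eq H K δ η D hh, ← Finset.sum_sub_distrib]
      exact Finset.sum_congr rfl fun a _ => by ring
    have hP : ∀ a, ∑ y, M.P h s a y * (value M H (polK H K δ η D k) (h + 1) y
        - VK H K δ η D k (h + 1) y) = ∑ y, M.P h s a y * value M H (polK H K δ η D k) (h + 1) y
        - ∑ y, M.P h s a y * VK H K δ η D k (h + 1) y := by
      intro a
      rw [← Finset.sum_sub_distrib]
      exact Finset.sum_congr rfl fun y _ => by ring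
    refine ⟨?_, ?_⟩
    · rw [hdiff]
      refine le_simplex_sum (hπ h s) fun a => ?_
      have h2 := (hopt k h hk hkK h1 hh s a).2
      have h3 := le_simplex_sum (M.P_mem h s a) fun y => (ih y).1
      rw [hP] at h3
      linarith
    · rw [width_eq M hh]
      refine le_min (by linarith [hval.2]) ?_
      rw [hdiff, stepAvg]
      refine simplex_sum_mono (hπ h s) fun a => ?_
      have hsplit : ∑ y, M.P h s a y * (2 * min (B h s a) H
          + width M H (polK H K δ η D k) (fun h s a => min (B h s a) H) (h + 1) y)
          = 2 * min (B h s a) H + ∑ y, M.P h s a y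
            * width M H (polK H K δ η D k) (fun h s a => min (B h s a) H) (h + 1) y := by
        simp only [mul_add, Finset.sum_add_distrib]
        rw [← Finset.sum_mul, (M.P_mem h s a).2, one_mul]
      rw [hsplit]
      have hw : 0 ≤ ∑ y, M.P h s a y
          * width M H (polK H K δ η D k) (fun h s a => min (B h s a) H) (h + 1) y :=
        le_simplex_sum (M.P_mem h s a) fun y => (width_mem M (by omega) hπ
          (fun h s a => le_min (hB0 h s a) (Nat.cast_nonneg _)) y).1
      -- Capping the bonus at `H` loses nothing: where it exceeds `H`, the trivial bound `c + P V^π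
      -- ≤ H` already suffices, by `1 ≤ h`.
      rcases le_total (B h s a) H with hcase | hcase
      · rw [min_eq_left hcase]
        have h2 := (hopt k h hk hkK h1 hh s a).1
        have h3 := simplex_sum_mono (M.P_mem h s a) fun y => (ih y).2
        rw [hP] at h3
        linarith [hB h h1 hh s a]
      · rw [min_eq_right hcase]
        have h3 := simplex_sum_le (M.P_mem h s a) fun y => (hval' y).2
        have h4 := QK_nonneg H K δ η D k h s a
        have h5 := (M.c_mem h s a).2
        push_cast at h3
        linarith

/-- Policy optimisation against a fixed policy, from a fixed state. -/
theorem sum_VK_sub_value_le (hopt : Optimism M H K δ η D)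
    (hη : ∀ k, 1 ≤ k → k ≤ K → 0 < η k) (hanti : ∀ k, 1 ≤ k → k < K → η (k + 1) ≤ η k)
    (π : Policy 𝒮 𝒜) {n : ℕ} (hn : 1 ≤ n) (hnK : n ≤ K) {h : ℕ} (hh : h ≤ H + 1) :
    1 ≤ h → ∀ s, ∑ k ∈ Finset.Icc 1 n, (VK H K δ η D k h s - value M H π.1 h s)
      ≤ (H + 1 - h) * (2 / η n + Fintype.card 𝒜 * (H : ℝ) ^ 2 * ∑ k ∈ Finset.Icc 1 n, η k) := by
  set R : ℝ := 2 / η n + Fintype.card 𝒜 * (H : ℝ) ^ 2 * ∑ k ∈ Finset.Icc 1 n, η k with hR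
  refine backward_induction (H := H) (p := fun h => 1 ≤ h → ∀ s, ∑ k ∈ Finset.Icc 1 n,
    (VK H K δ η D k h s - value M H π.1 h s) ≤ (H + 1 - h) * R) ?_ ?_ hh
  · intro _ s
    simp [VK_top, value_eq_zero M (show H < H + 1 by omega)]
  · intro h hh ih h1 s
    have homd : ∑ k ∈ Finset.Icc 1 n, ∑ a, QK H K δ η D k h s a
        * (polK H K δ η D k h s a - π.1 h s a) ≤ R := by
      refine mirror_regret hη hanti (π.2 h s) (fun k => polK_mem H K δ η D k h s)
        (fun k hk => polK_succ H K δ η D hk h s) (fun k hk hkK => ?_) hn hnK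
      calc ∑ a, QK H K δ η D k h s a ^ 2 ≤ ∑ _a : 𝒜, (H : ℝ) ^ 2 :=
            Finset.sum_le_sum fun a _ => pow_le_pow_left₀ (QK_nonneg H K δ η D k h s a)
              (QK_le_of_optimism hopt hk hkK hh h1 s a) 2
        _ = _ := by simp
    -- Performance difference in extended form: `Q^k ≤ c + P V^k` is used under the comparator `π`,
    -- so the recursion runs along the fixed dynamics of `π`.
    have hone : ∀ k ∈ Finset.Icc 1 n, VK H K δ η D k h s - value M H π.1 h s
        ≤ ∑ a, QK H K δ η D k h s a * (polK H K δ η D k h s a - π.1 h s a)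
          + ∑ a, π.1 h s a * ∑ y, M.P h s a y
            * (VK H K δ η D k (h + 1) y - value M H π.1 (h + 1) y) := by
      intro k hk
      rw [Finset.mem_Icc] at hk
      rw [VK_eq H K δ η D hh, value_bellman M π.2 hh, ← Finset.sum_sub_distrib,
        ← Finset.sum_add_distrib]
      refine Finset.sum_le_sum fun a _ => ?_
      have h2 := (hopt k h hk.1 (hk.2.trans hnK) h1 hh s a).2
      have h3 := mul_nonneg ((π.2 h s).1 a) (neg_nonneg.2 h2)
      simp only [mul_sub, Finset.sum_sub_distrib]
      nlinarith
    refine (Finset.sum_le_sum hone).trans ?_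
    rw [Finset.sum_add_distrib, Finset.sum_comm (s := Finset.Icc 1 n) (t := Finset.univ)
      (f := fun k a => π.1 h s a * ∑ y, M.P h s a y
        * (VK H K δ η D k (h + 1) y - value M H π.1 (h + 1) y))]
    -- The weights do not depend on `k`, so the sum over episodes moves inside and the induction
    -- hypothesis applies at each next state separately.
    have hrest : ∑ a, ∑ k ∈ Finset.Icc 1 n, π.1 h s a * ∑ y, M.P h s a y
        * (VK H K δ η D k (h + 1) y - value M H π.1 (h + 1) y) ≤ (H - h) * R := by
      simp only [← Finset.mul_sum]
      refine simplex_sum_le (π.2 h s) fun a => ?_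
      rw [Finset.sum_comm]
      simp only [← Finset.mul_sum]
      refine simplex_sum_le (M.P_mem h s a) fun y => ?_
      have := ih (by omega) y
      push_cast at this
      linarith
    linarith

/-! ### Bounds along the trajectory -/

variable (M H D) in
/-- The deviation of `g a_h^k s_{h+1}^k` from its conditional mean given the past. -/
def stepNoise (π : ℕ → 𝒮 → 𝒜 → ℝ) (g : 𝒜 → 𝒮 → ℝ) (k h : ℕ) : ℝ :=
  g (D.act k h) (D.state k (h + 1)) - stepAvg M π h (D.state k h) g

/-- Drop the truncation and write the average as the realised value minus its noise, step after
step; hence the negated function inside `stepNoise`. -/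
theorem width_le_sum {π B : ℕ → 𝒮 → 𝒜 → ℝ} (k : ℕ) {h : ℕ} (hh : h ≤ H + 1) :
    width M H π B h (D.state k h) ≤ ∑ j ∈ Finset.Icc h H,
      (2 * B j (D.state k j) (D.act k j) + stepNoise M D π
        (fun a y => -(2 * B j (D.state k j) a + width M H π B (j + 1) y)) k j) := by
  refine backward_induction (H := H) (p := fun h => width M H π B h (D.state k h)
    ≤ ∑ j ∈ Finset.Icc h H, (2 * B j (D.state k j) (D.act k j) + stepNoise M D π
        (fun a y => -(2 * B j (D.state k j) a + width M H π B (j + 1) y)) k j)) ?_ ?_ hh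
  · rw [width_top]
    simp
  · intro h hh ih
    rw [← Finset.sum_Ioc_add_eq_sum_Icc hh]
    have hIoc : Finset.Ioc h H = Finset.Icc (h + 1) H := by
      ext j
      simp only [Finset.mem_Ioc, Finset.mem_Icc]
      omega
    rw [hIoc]
    have h1 : width M H π B h (D.state k h) ≤ stepAvg M π h (D.state k h)
        fun a y => 2 * B h (D.state k h) a + width M H π B (h + 1) y := by
      rw [width_eq M hh]
      exact min_le_right _ _
    simp only [stepNoise, stepAvg_neg] at ih ⊢
    linarith

/-- The optimal value is at most the one-step lookahead of any policy, so the average of the gap at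
the next step is at most the gap now. This carries the bound from the fixed initial state to the
random later ones, where the fixed-state mirror descent estimate is not directly available. -/
theorem value_sub_optValue_le_sum {π : ℕ → 𝒮 → 𝒜 → ℝ} (hπ : ∀ h s, π h s ∈ stdSimplex ℝ 𝒜)
    (k : ℕ) {h : ℕ} (h1 : 1 ≤ h) (hh : h ≤ H + 1) :
    value M H π h (D.state k h) - optValue M H h (D.state k h)
      ≤ value M H π 1 (D.state k 1) - optValue M H 1 (D.state k 1)
        + ∑ j ∈ Finset.Ico 1 h, stepNoise M D π
          (fun _ y => value M H π (j + 1) y - optValue M H (j + 1) y) k j := by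
  induction h, h1 using Nat.le_induction with
  | base => simp
  | succ h h1 ih =>
    have ih := ih (by omega)
    rw [Finset.sum_Ico_succ_top h1]
    have h2 : stepAvg M π h (D.state k h)
        (fun _ y => value M H π (h + 1) y - optValue M H (h + 1) y)
        ≤ value M H π h (D.state k h) - optValue M H h (D.state k h) := by
      have h3 := optValue_le_average M (show h ≤ H by omega) (D.state k h)
        (hπ h (D.state k h))
      have h4 : ∑ a, π h (D.state k h) a * (M.c h (D.state k h) a
            + ∑ y, M.P h (D.state k h) a y * value M H π (h + 1) y)
          - ∑ a, π h (D.state k h) a * (M.c h (D.state k h) a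
            + ∑ y, M.P h (D.state k h) a y * optValue M H (h + 1) y)
          = stepAvg M π h (D.state k h)
            (fun _ y => value M H π (h + 1) y - optValue M H (h + 1) y) := by
        rw [stepAvg, ← Finset.sum_sub_distrib]
        refine Finset.sum_congr rfl fun a _ => ?_
        simp only [mul_sub, Finset.sum_sub_distrib]
        ring
      rw [value_bellman M hπ (show h ≤ H by omega)]
      linarith
    simp only [stepNoise] at ih ⊢
    linarith

end Algorithm

section Algorithm

variable {𝒮 𝒜 : Type*} [Fintype 𝒮] [DecidableEq 𝒮] [Fintype 𝒜] [DecidableEq 𝒜]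

/-! ### The size of the bonus -/

/-- The logarithmic factor `ln (2 S A H K / δ)` of the regret bound. -/
def logFactor (𝒮 𝒜 : Type*) [Fintype 𝒮] [Fintype 𝒜] (H K : ℕ) (δ : ℝ) : ℝ :=
  Real.log (2 * Fintype.card 𝒮 * Fintype.card 𝒜 * H * K / δ)

section LogFactor

variable [Nonempty 𝒮] [Nonempty 𝒜] {H K : ℕ} {δ : ℝ}

theorem two_mul_le_log_arg (hH : 1 ≤ H) (hK : 1 ≤ K) (hδ : 0 < δ) (hδ1 : δ < 1) :
    2 * (H : ℝ) ≤ 2 * Fintype.card 𝒮 * Fintype.card 𝒜 * H * K / δ := by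
  have hS : (1 : ℝ) ≤ Fintype.card 𝒮 := by exact_mod_cast Fintype.card_pos
  have hA : (1 : ℝ) ≤ Fintype.card 𝒜 := by exact_mod_cast Fintype.card_pos
  have hK' : (1 : ℝ) ≤ K := by exact_mod_cast hK
  have hH' : (1 : ℝ) ≤ H := by exact_mod_cast hH
  rw [le_div_iff₀ hδ]
  calc 2 * (H : ℝ) * δ ≤ 2 * (H : ℝ) * 1 := by gcongr
    _ ≤ 2 * (H : ℝ) * (Fintype.card 𝒮 * Fintype.card 𝒜 * K) := by
        gcongr
        exact one_le_mul_of_one_le_of_one_le (one_le_mul_of_one_le_of_one_le hS hA) hK'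
    _ = _ := by ring

/-- The bound `ln 2 > 0.69` lets powers of the logarithm be compared: later steps use `1 ≤ 2 l`, `10
l ≤ 16 l²` and `20 l ≤ 36 l²`. -/
theorem logFactor_ge (hH : 1 ≤ H) (hK : 1 ≤ K) (hδ : 0 < δ) (hδ1 : δ < 1) :
    (69 : ℝ) / 100 ≤ logFactor 𝒮 𝒜 H K δ := by
  have hH' : (1 : ℝ) ≤ H := by exact_mod_cast hH
  have h1 : Real.log 2 ≤ logFactor 𝒮 𝒜 H K δ :=
    Real.log_le_log (by norm_num) (by linarith [two_mul_le_log_arg (𝒮 := 𝒮) (𝒜 := 𝒜) hH hK hδ hδ1])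
  linarith [Real.log_two_gt_d9]

/-- With `x` the argument of `logFactor`, the argument on the left is `(5/2) m H x`. Since `x ≥ 2 H`
and `x ≥ 2`, this is at most `x ^ 5`, whence the factor `5`. -/
theorem logTerm_le (hH : 1 ≤ H) (hK : 1 ≤ K) (hδ : 0 < δ) (hδ1 : δ < 1) {m : ℝ} (hm : 0 < m)
    (hm3 : m ≤ 3) : logTerm 𝒮 𝒜 H δ m (H * K) ≤ 5 * logFactor 𝒮 𝒜 H K δ := by
  have hS : (0 : ℝ) < Fintype.card 𝒮 := by exact_mod_cast Fintype.card_pos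
  have hA : (0 : ℝ) < Fintype.card 𝒜 := by exact_mod_cast Fintype.card_pos
  have hK' : (1 : ℝ) ≤ K := by exact_mod_cast hK
  have hH' : (1 : ℝ) ≤ H := by exact_mod_cast hH
  have hx := two_mul_le_log_arg (𝒮 := 𝒮) (𝒜 := 𝒜) hH hK hδ hδ1
  unfold logTerm logFactor
  set x : ℝ := 2 * Fintype.card 𝒮 * Fintype.card 𝒜 * H * K / δ with hxdef
  have hx2 : 2 ≤ x := by linarith
  have h5 : 5 * Real.log x = Real.log (x ^ 5) := by
    rw [Real.log_pow]
    norm_num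
  rw [h5]
  have he : m * Fintype.card 𝒮 * Fintype.card 𝒜 * H * (H * K) / (δ / 5) = 5 / 2 * m * H * x := by
    rw [hxdef]
    field_simp
  rw [he]
  refine Real.log_le_log (by positivity) ?_
  have h8 : 8 ≤ x ^ 3 := by
    calc (8 : ℝ) = 2 ^ 3 := by norm_num
      _ ≤ x ^ 3 := by gcongr
  calc 5 / 2 * m * H * x ≤ 5 / 2 * 3 * (x / 2) * x := by gcongr; linarith
    _ ≤ 8 * x ^ 2 := by nlinarith [sq_nonneg x]
    _ ≤ x ^ 3 * x ^ 2 := by gcongr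
    _ = x ^ 5 := by ring

end LogFactor

/-- A bound for the bonus of episode `k` that depends on earlier episodes only. -/
def bonusCap (H K : ℕ) (δ : ℝ) (D : Record 𝒮 𝒜) (k h : ℕ) (s : 𝒮) (a : 𝒜) : ℝ :=
  10 * H * √(Fintype.card 𝒮 : ℝ) * logFactor 𝒮 𝒜 H K δ
    * (1 / √(max (visitsSA D (k - 1) h s a : ℝ) 1))

variable [Nonempty 𝒜] {M : MDP 𝒮 𝒜} {H K : ℕ} {δ : ℝ} {η : ℕ → ℝ} {D : Record 𝒮 𝒜}

/-- Replacing the count after episode `k` by the one before it makes the bonus bound predictable. -/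
theorem prior_le_cnt (k h : ℕ) (s : 𝒮) (a : 𝒜) :
    max (visitsSA D (k - 1) h s a : ℝ) 1 ≤ cnt D k h s a := by
  refine max_le_max_right _ (Nat.cast_le.2 (Finset.card_le_card ?_))
  exact Finset.filter_subset_filter _ (Finset.Icc_subset_Icc_right (Nat.sub_le _ _))

theorem bonusCap_nonneg [Nonempty 𝒮] (hH : 1 ≤ H) (hK : 1 ≤ K) (hδ : 0 < δ) (hδ1 : δ < 1)
    (k h : ℕ) (s : 𝒮) (a : 𝒜) : 0 ≤ bonusCap H K δ D k h s a := by
  have := logFactor_ge (𝒮 := 𝒮) (𝒜 := 𝒜) hH hK hδ hδ1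
  have : 0 ≤ logFactor 𝒮 𝒜 H K δ := by linarith
  unfold bonusCap
  positivity

/-- Only the second entry of the minimum is needed. Its cost part contributes `4` and its transition
part `6` to the constant `10`. -/
theorem bK_le_bonusCap [Nonempty 𝒮] (hH : 1 ≤ H) (hK : 1 ≤ K) (hδ : 0 < δ) (hδ1 : δ < 1)
    (k h : ℕ) (s : 𝒮) (a : 𝒜) : bK H K δ η D k h s a ≤ bonusCap H K δ D k h s a := by
  refine (min_le_right _ _).trans ?_
  have hl := logFactor_ge (𝒮 := 𝒮) (𝒜 := 𝒜) hH hK hδ hδ1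
  have h2 := logTerm_le (𝒮 := 𝒮) (𝒜 := 𝒜) hH hK hδ hδ1 (m := 2) (by norm_num) (by norm_num)
  have h3 := logTerm_le (𝒮 := 𝒮) (𝒜 := 𝒜) hH hK hδ hδ1 (m := 3) (by norm_num) (by norm_num)
  have hcnt := prior_le_cnt (D := D) k h s a
  unfold bonusCap
  set l := logFactor 𝒮 𝒜 H K δ
  set m : ℝ := max (visitsSA D (k - 1) h s a : ℝ) 1
  have hm : 0 < m := lt_of_lt_of_le one_pos (le_max_right _ _)
  have hS : (1 : ℝ) ≤ Fintype.card 𝒮 := by exact_mod_cast Fintype.card_pos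
  have hH' : (1 : ℝ) ≤ H := by exact_mod_cast hH
  have hsm : 0 < √m := Real.sqrt_pos.2 hm
  have hsS : 1 ≤ √(Fintype.card 𝒮 : ℝ) := Real.one_le_sqrt.2 hS
  have hsqS : √(Fintype.card 𝒮 : ℝ) ^ 2 = Fintype.card 𝒮 := Real.sq_sqrt (by linarith)
  have hsqm : √m ^ 2 = m := Real.sq_sqrt hm.le
  have t1 : √(2 * logTerm 𝒮 𝒜 H δ 2 (H * K) / cnt D k h s a) ≤ 4 * l * (1 / √m) := by
    rw [mul_one_div, Real.sqrt_le_left (by positivity), div_pow, hsqm]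
    refine div_le_div₀ (by positivity) ?_ hm hcnt
    nlinarith
  have t2 : √(4 * Fintype.card 𝒮 * logTerm 𝒮 𝒜 H δ 3 (H * K) / cnt D k h s a)
      ≤ 6 * √(Fintype.card 𝒮 : ℝ) * l * (1 / √m) := by
    rw [mul_one_div, Real.sqrt_le_left (by positivity), div_pow, hsqm]
    refine div_le_div₀ (by positivity) ?_ hm hcnt
    have : (6 * √(Fintype.card 𝒮 : ℝ) * l) ^ 2 = Fintype.card 𝒮 * (36 * l ^ 2) := by
      rw [mul_pow, mul_pow, hsqS]
      ring
    rw [this]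
    calc 4 * Fintype.card 𝒮 * logTerm 𝒮 𝒜 H δ 3 (H * K)
        ≤ 4 * Fintype.card 𝒮 * (5 * l) := by gcongr
      _ = Fintype.card 𝒮 * (20 * l) := by ring
      _ ≤ Fintype.card 𝒮 * (36 * l ^ 2) :=
        mul_le_mul_of_nonneg_left (by nlinarith) (Nat.cast_nonneg _)
  have hpos : 0 ≤ l * (1 / √m) := by positivity
  calc _ ≤ 4 * l * (1 / √m) + H * (6 * √(Fintype.card 𝒮 : ℝ) * l * (1 / √m)) := by gcongr
    _ ≤ 4 * (H * √(Fintype.card 𝒮 : ℝ)) * (l * (1 / √m))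
        + H * (6 * √(Fintype.card 𝒮 : ℝ) * l * (1 / √m)) := by
      have : 1 ≤ H * √(Fintype.card 𝒮 : ℝ) := one_le_mul_of_one_le_of_one_le hH' hsS
      nlinarith [mul_le_mul_of_nonneg_right this hpos]
    _ = _ := by ring

theorem sum_bonusCap_le (h n : ℕ) (hl : 0 ≤ logFactor 𝒮 𝒜 H K δ) :
    ∑ k ∈ Finset.Icc 1 n, bonusCap H K δ D k h (D.state k h) (D.act k h)
      ≤ 30 * logFactor 𝒮 𝒜 H K δ * H * √(Fintype.card 𝒮 : ℝ)
        * √(Fintype.card 𝒮 * Fintype.card 𝒜 * n) := by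
  have h1 := sum_inv_sqrt_prior_le (fun i => (D.state i h, D.act i h)) n
  simp only [Prod.mk.injEq, Fintype.card_prod, Nat.cast_mul] at h1
  unfold bonusCap
  rw [← Finset.mul_sum]
  calc _ ≤ 10 * H * √(Fintype.card 𝒮 : ℝ) * logFactor 𝒮 𝒜 H K δ
        * (3 * √(Fintype.card 𝒮 * Fintype.card 𝒜 * n)) :=
        mul_le_mul_of_nonneg_left h1 (by positivity)
    _ = _ := by ring

/-! ### The two noise terms -/

variable (M H K δ η D) in
/-- The function of the action and next state whose noise enters the bonus sums. -/
def widthFn (k h : ℕ) (a : 𝒜) (y : 𝒮) : ℝ :=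
  -(2 * min (bonusCap H K δ D k h (D.state k h) a) H
    + width M H (polK H K δ η D k) (fun h s a => min (bonusCap H K δ D k h s a) H) (h + 1) y)

variable (M H K δ η D) in
/-- The function of the action and next state whose noise relates the regrets of different steps. -/
def gapFn (k h : ℕ) (_ : 𝒜) (y : 𝒮) : ℝ :=
  value M H (polK H K δ η D k) (h + 1) y - optValue M H (h + 1) y

/-- This is what both truncations at `H` are for: the capped bonus contributes at most `2 H` and the
continuation at most `H`, whether or not optimism holds. -/
theorem abs_widthFn_le [Nonempty 𝒮] (hH : 1 ≤ H) (hK : 1 ≤ K) (hδ : 0 < δ) (hδ1 : δ < 1)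
    {k h : ℕ} (hh : h ≤ H) (a : 𝒜) (y : 𝒮) : |widthFn M H K δ η D k h a y| ≤ 3 * H := by
  have h0 : ∀ h s a, 0 ≤ min (bonusCap H K δ D k h s a) H := fun h s a =>
    le_min (bonusCap_nonneg hH hK hδ hδ1 k h s a) (Nat.cast_nonneg _)
  have h1 := width_mem M (show h + 1 ≤ H + 1 by omega) (polK_mem H K δ η D k) h0 y
  have h2 := h0 h (D.state k h) a
  have h3 := min_le_right (bonusCap H K δ D k h (D.state k h) a) (H : ℝ)
  rw [widthFn, abs_neg, abs_of_nonneg (by linarith)]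
  linarith

theorem abs_gapFn_le {k h : ℕ} (hh : h ≤ H) (a : 𝒜) (y : 𝒮) :
    |gapFn M H K δ η D k h a y| ≤ H := by
  have h1 := value_mem M (polK_mem H K δ η D k) (show h + 1 ≤ H + 1 by omega) y
  have h2 := optValue_le_value M (polK_mem H K δ η D k) (show h + 1 ≤ H + 1 by omega) y
  have h3 := optValue_nonneg M (show h + 1 ≤ H + 1 by omega) y
  rw [gapFn, abs_of_nonneg (by linarith)]
  have : (0 : ℝ) ≤ h := Nat.cast_nonneg h
  push_cast at h1
  linarith [h1.2]

/-- The sum of the gaps between the values of the policies played and the estimates. -/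
theorem sum_value_sub_VK_le [Nonempty 𝒮] (hH : 1 ≤ H) (hδ : 0 < δ) (hδ1 : δ < 1)
    (hopt : Optimism M H K δ η D) {n : ℕ} (hn : 1 ≤ n) (hnK : n ≤ K)
    (hnoise : ∀ h, 1 ≤ h → h ≤ H → ∑ k ∈ Finset.Icc 1 n,
      stepNoise M D (polK H K δ η D k) (widthFn M H K δ η D k h) k h
        ≤ 12 * logFactor 𝒮 𝒜 H K δ * H * √n)
    {h : ℕ} (h1 : 1 ≤ h) (hh : h ≤ H) :
    ∑ k ∈ Finset.Icc 1 n,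
        (value M H (polK H K δ η D k) h (D.state k h) - VK H K δ η D k h (D.state k h))
      ≤ 72 * logFactor 𝒮 𝒜 H K δ * √((Fintype.card 𝒮 : ℝ) ^ 2 * Fintype.card 𝒜 * H ^ 4 * n) := by
  have hK : 1 ≤ K := hn.trans hnK
  have hl := logFactor_ge (𝒮 := 𝒮) (𝒜 := 𝒜) hH hK hδ hδ1
  set l := logFactor 𝒮 𝒜 H K δ with hldef
  have hl0 : 0 ≤ l := by linarith
  have hS : (1 : ℝ) ≤ Fintype.card 𝒮 := by exact_mod_cast Fintype.card_pos
  have hA : (1 : ℝ) ≤ Fintype.card 𝒜 := by exact_mod_cast Fintype.card_pos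
  set U := √((Fintype.card 𝒮 : ℝ) ^ 2 * Fintype.card 𝒜 * n) with hU
  have hUU : √((Fintype.card 𝒮 : ℝ) ^ 2 * Fintype.card 𝒜 * H ^ 4 * n) = H * (H * U) := by
    rw [show (Fintype.card 𝒮 : ℝ) ^ 2 * Fintype.card 𝒜 * H ^ 4 * n
      = ((H : ℝ) * H) ^ 2 * ((Fintype.card 𝒮 : ℝ) ^ 2 * Fintype.card 𝒜 * n) by ring,
      Real.sqrt_mul (sq_nonneg _), Real.sqrt_sq (by positivity), mul_assoc]
  have hSU : √(Fintype.card 𝒮 : ℝ) * √(Fintype.card 𝒮 * Fintype.card 𝒜 * n) = U := by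
    rw [← Real.sqrt_mul (by positivity), hU]
    congr 1
    ring
  have hnU : √(n : ℝ) ≤ U := by
    refine Real.sqrt_le_sqrt (le_mul_of_one_le_left (Nat.cast_nonneg _) ?_)
    exact one_le_mul_of_one_le_of_one_le (one_le_pow₀ hS) hA
  -- Here `72 = 2 · 30 + 12`: twice the sum of bonuses plus the noise.
  have hstep : ∀ j ∈ Finset.Icc h H, ∑ k ∈ Finset.Icc 1 n,
      (2 * min (bonusCap H K δ D k j (D.state k j) (D.act k j)) H
        + stepNoise M D (polK H K δ η D k) (widthFn M H K δ η D k j) k j) ≤ 72 * l * (H * U) := by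
    intro j hj
    rw [Finset.mem_Icc] at hj
    rw [Finset.sum_add_distrib, ← Finset.mul_sum]
    have a1 := sum_bonusCap_le (D := D) j n (hldef ▸ hl0)
    have a2 : ∑ k ∈ Finset.Icc 1 n, min (bonusCap H K δ D k j (D.state k j) (D.act k j)) (H : ℝ)
        ≤ ∑ k ∈ Finset.Icc 1 n, bonusCap H K δ D k j (D.state k j) (D.act k j) :=
      Finset.sum_le_sum fun _ _ => min_le_left _ _
    have a3 := hnoise j (h1.trans hj.1) hj.2
    rw [← hldef, mul_assoc _ √(Fintype.card 𝒮 : ℝ), hSU] at a1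
    have a4 : 12 * l * H * √n ≤ 12 * l * H * U := by gcongr
    linarith
  calc _ ≤ ∑ k ∈ Finset.Icc 1 n, ∑ j ∈ Finset.Icc h H,
        (2 * min (bonusCap H K δ D k j (D.state k j) (D.act k j)) H
        + stepNoise M D (polK H K δ η D k) (widthFn M H K δ η D k j) k j) := by
        refine Finset.sum_le_sum fun k hk => ?_
        rw [Finset.mem_Icc] at hk
        exact (value_sub_VK_mem hopt hk.1 (hk.2.trans hnK)
          (fun h _ _ s a => bK_le_bonusCap hH hK hδ hδ1 k h s a)
          (fun h s a => bonusCap_nonneg hH hK hδ hδ1 k h s a)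
          (show h ≤ H + 1 by omega) h1 _).2.trans (width_le_sum k (by omega))
    _ = ∑ j ∈ Finset.Icc h H, ∑ k ∈ Finset.Icc 1 n,
        (2 * min (bonusCap H K δ D k j (D.state k j) (D.act k j)) H
        + stepNoise M D (polK H K δ η D k) (widthFn M H K δ η D k j) k j) := Finset.sum_comm
    _ ≤ ∑ j ∈ Finset.Icc h H, 72 * l * (H * U) := Finset.sum_le_sum hstep
    _ ≤ H * (72 * l * (H * U)) := by
        rw [Finset.sum_const, nsmul_eq_mul, Nat.card_Icc]
        refine mul_le_mul_of_nonneg_right ?_ (by positivity)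
        exact_mod_cast (show H + 1 - h ≤ H by omega)
    _ = _ := by
        rw [hUU]
        ring

/-- The policy optimisation error from a fixed state at step `1`. -/
theorem sum_VK_sub_optValue_le {c₁ c₂ : ℝ} (hc₁ : 0 < c₁) (hc₂ : 0 < c₂) (hH : 1 ≤ H)
    (hanti : ∀ t, 1 ≤ t → t < K → η (t + 1) ≤ η t)
    (hη : ∀ t : ℕ, 1 ≤ t → t ≤ K →
      c₁ * √(1 / ((H : ℝ) ^ 2 * Fintype.card 𝒜 * t)) ≤ η t ∧
        η t ≤ c₂ * √(1 / ((H : ℝ) ^ 2 * Fintype.card 𝒜 * t)))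
    (hopt : Optimism M H K δ η D) {n : ℕ} (hn : 1 ≤ n) (hnK : n ≤ K) (s : 𝒮) :
    ∑ k ∈ Finset.Icc 1 n, (VK H K δ η D k 1 s - optValue M H 1 s)
      ≤ (2 / c₁ + 2 * c₂) * (H ^ 2 * √(Fintype.card 𝒜 * n)) := by
  have hA : (1 : ℝ) ≤ Fintype.card 𝒜 := by exact_mod_cast Fintype.card_pos
  have hH' : (1 : ℝ) ≤ H := by exact_mod_cast hH
  set A : ℝ := ((Fintype.card 𝒜 : ℕ) : ℝ)
  have hsA : 0 < √A := Real.sqrt_pos.2 (by linarith)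
  have hsqA : √A ^ 2 = A := Real.sq_sqrt (by linarith)
  have hform : ∀ t : ℕ, √(1 / ((H : ℝ) ^ 2 * A * t)) = 1 / (H * √A) * (1 / √t) := by
    intro t
    rw [Real.sqrt_div zero_le_one, Real.sqrt_one, Real.sqrt_mul (by positivity),
      Real.sqrt_mul (by positivity), Real.sqrt_sq (by positivity), one_div_mul_one_div]
  have hpos : ∀ k, 1 ≤ k → k ≤ K → 0 < η k := by
    intro k hk hkK
    have hk' : (0 : ℝ) < k := by exact_mod_cast hk
    exact lt_of_lt_of_le (by positivity) (hη k hk hkK).1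
  obtain ⟨π, hπ⟩ := exists_value_eq_optValue M H
  have h1 := sum_VK_sub_value_le hopt hpos hanti π hn hnK (show 1 ≤ H + 1 by omega) le_rfl s
  simp only [hπ 1 (show 1 ≤ H + 1 by omega)] at h1
  refine h1.trans ?_
  have hn' : (0 : ℝ) < n := by exact_mod_cast hn
  have hsn : 0 < √(n : ℝ) := Real.sqrt_pos.2 hn'
  have b1 : 2 / η n ≤ 2 / c₁ * (H * √A * √n) := by
    have := (hη n hn hnK).1
    rw [hform] at this
    calc 2 / η n ≤ 2 / (c₁ * (1 / (H * √A) * (1 / √n))) := by gcongr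
      _ = _ := by field_simp
  have b2 : ∑ k ∈ Finset.Icc 1 n, η k ≤ c₂ * (1 / (H * √A)) * (2 * √n) := by
    calc ∑ k ∈ Finset.Icc 1 n, η k ≤ ∑ k ∈ Finset.Icc 1 n, c₂ * (1 / (H * √A)) * (1 / √(k : ℝ)) := by
          refine Finset.sum_le_sum fun k hk => ?_
          rw [Finset.mem_Icc] at hk
          have := (hη k hk.1 (hk.2.trans hnK)).2
          rwa [hform, ← mul_assoc] at this
      _ ≤ _ := by
          rw [← Finset.mul_sum]
          exact mul_le_mul_of_nonneg_left (sum_inv_sqrt_le n) (by positivity)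
  have b3 : A * (H : ℝ) ^ 2 * (c₂ * (1 / (H * √A)) * (2 * √n)) = 2 * c₂ * (H * √A * √n) := by
    have : A = √A * √A := by rw [← sq, hsqA]
    rw [show A * (H : ℝ) ^ 2 * (c₂ * (1 / (H * √A)) * (2 * √n))
      = A * ((H : ℝ) ^ 2 * (c₂ * (1 / (H * √A)) * (2 * √n))) by ring]
    nth_rewrite 1 [this]
    field_simp
  have b4 := mul_le_mul_of_nonneg_left b2 (show 0 ≤ A * (H : ℝ) ^ 2 by positivity)
  rw [Real.sqrt_mul (by linarith)]
  calc ((H : ℝ) + 1 - (1 : ℕ)) * (2 / η n + A * (H : ℝ) ^ 2 * ∑ k ∈ Finset.Icc 1 n, η k)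
      ≤ ((H : ℝ) + 1 - (1 : ℕ)) * (2 / c₁ * (H * √A * √n) + 2 * c₂ * (H * √A * √n)) := by
        refine mul_le_mul_of_nonneg_left (by linarith) ?_
        push_cast
        linarith
    _ = _ := by
        push_cast
        ring

/-- The regret and the estimation error are controlled by the two noise terms. -/
theorem bounds_of_noise [Nonempty 𝒮] {c₁ c₂ : ℝ} (hc₁ : 0 < c₁) (hc₂ : 0 < c₂) (hδ : 0 < δ)
    (hδ1 : δ < 1) (hanti : ∀ t, 1 ≤ t → t < K → η (t + 1) ≤ η t)
    (hη : ∀ t : ℕ, 1 ≤ t → t ≤ K →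
      c₁ * √(1 / ((H : ℝ) ^ 2 * Fintype.card 𝒜 * t)) ≤ η t ∧
        η t ≤ c₂ * √(1 / ((H : ℝ) ^ 2 * Fintype.card 𝒜 * t)))
    (hopt : Optimism M H K δ η D) {s₁ : 𝒮} (hstart : ∀ k, 1 ≤ k → k ≤ K → D.state k 1 = s₁)
    {n : ℕ} (hn : 1 ≤ n) (hnK : n ≤ K)
    (hnoise : ∀ h, 1 ≤ h → h ≤ H → ∑ k ∈ Finset.Icc 1 n,
      stepNoise M D (polK H K δ η D k) (widthFn M H K δ η D k h) k h
        ≤ 12 * logFactor 𝒮 𝒜 H K δ * H * √n)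
    (hnoise' : ∀ h, 1 ≤ h → h ≤ H → ∑ k ∈ Finset.Icc 1 n,
      stepNoise M D (polK H K δ η D k) (gapFn M H K δ η D k h) k h
        ≤ 4 * logFactor 𝒮 𝒜 H K δ * H * √n)
    {h : ℕ} (h1 : 1 ≤ h) (hh : h ≤ H) :
    regret M H K δ η D h n ≤ (150 + 4 / c₁ + 4 * c₂) * logFactor 𝒮 𝒜 H K δ
        * √((Fintype.card 𝒮 : ℝ) ^ 2 * Fintype.card 𝒜 * H ^ 4 * n) ∧
      ∑ k ∈ Finset.Icc 1 n, |VK H K δ η D k h (D.state k h) - optValue M H h (D.state k h)|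
        ≤ (150 + 4 / c₁ + 4 * c₂) * logFactor 𝒮 𝒜 H K δ
          * √((Fintype.card 𝒮 : ℝ) ^ 2 * Fintype.card 𝒜 * H ^ 4 * n) := by
  have hH : 1 ≤ H := h1.trans hh
  have hK : 1 ≤ K := hn.trans hnK
  have hl := logFactor_ge (𝒮 := 𝒮) (𝒜 := 𝒜) hH hK hδ hδ1
  have hS : (1 : ℝ) ≤ Fintype.card 𝒮 := by exact_mod_cast Fintype.card_pos
  have hA : (1 : ℝ) ≤ Fintype.card 𝒜 := by exact_mod_cast Fintype.card_pos
  have hV := fun h h1 hh => sum_value_sub_VK_le (h := h) hH hδ hδ1 hopt hn hnK hnoise h1 hh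
  have hP := sum_VK_sub_optValue_le hc₁ hc₂ hH hanti hη hopt hn hnK s₁
  have hπ := fun k => polK_mem H K δ η D k
  set l := logFactor 𝒮 𝒜 H K δ with hldef
  set U := √((Fintype.card 𝒮 : ℝ) ^ 2 * Fintype.card 𝒜 * H ^ 4 * n) with hU
  have hU0 : 0 ≤ U := Real.sqrt_nonneg _
  have hnU : (H : ℝ) ^ 2 * √n ≤ U := by
    refine Real.le_sqrt_of_sq_le ?_
    rw [mul_pow, Real.sq_sqrt (Nat.cast_nonneg n)]
    calc ((H : ℝ) ^ 2) ^ 2 * n = 1 * ((H : ℝ) ^ 4 * n) := by ring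
      _ ≤ ((Fintype.card 𝒮 : ℝ) ^ 2 * Fintype.card 𝒜) * ((H : ℝ) ^ 4 * n) := by
          gcongr
          exact one_le_mul_of_one_le_of_one_le (one_le_pow₀ hS) hA
      _ = _ := by ring
  have hAU : (H : ℝ) ^ 2 * √(Fintype.card 𝒜 * n) ≤ U := by
    refine Real.le_sqrt_of_sq_le ?_
    rw [mul_pow, Real.sq_sqrt (by positivity)]
    calc ((H : ℝ) ^ 2) ^ 2 * (Fintype.card 𝒜 * n) = 1 * (Fintype.card 𝒜 * (H : ℝ) ^ 4 * n) := by
          ring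
      _ ≤ (Fintype.card 𝒮 : ℝ) ^ 2 * (Fintype.card 𝒜 * (H : ℝ) ^ 4 * n) := by
          gcongr
          exact one_le_pow₀ hS
      _ = _ := by ring
  have hP' : ∑ k ∈ Finset.Icc 1 n, (VK H K δ η D k 1 s₁ - optValue M H 1 s₁)
      ≤ (4 / c₁ + 4 * c₂) * l * U := by
    refine hP.trans ?_
    calc (2 / c₁ + 2 * c₂) * ((H : ℝ) ^ 2 * √(Fintype.card 𝒜 * n)) ≤ (2 / c₁ + 2 * c₂) * U := by
          gcongr
      _ ≤ (2 / c₁ + 2 * c₂) * (2 * l * U) := by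
          gcongr
          nlinarith
      _ = _ := by ring
  -- The estimation gap plus the optimisation error, joined at the common initial state `s₁`.
  have hreg1 : ∑ k ∈ Finset.Icc 1 n, (value M H (polK H K δ η D k) 1 (D.state k 1)
      - optValue M H 1 (D.state k 1)) ≤ (72 + 4 / c₁ + 4 * c₂) * l * U := by
    have e : ∑ k ∈ Finset.Icc 1 n, (value M H (polK H K δ η D k) 1 (D.state k 1)
        - optValue M H 1 (D.state k 1))
        = ∑ k ∈ Finset.Icc 1 n, (value M H (polK H K δ η D k) 1 (D.state k 1)
          - VK H K δ η D k 1 (D.state k 1))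
          + ∑ k ∈ Finset.Icc 1 n, (VK H K δ η D k 1 s₁ - optValue M H 1 s₁) := by
      rw [← Finset.sum_add_distrib]
      refine Finset.sum_congr rfl fun k hk => ?_
      rw [Finset.mem_Icc] at hk
      rw [hstart k hk.1 (hk.2.trans hnK)]
      ring
    rw [e]
    linarith [hV 1 le_rfl hH]
  have hreg : regret M H K δ η D h n ≤ (76 + 4 / c₁ + 4 * c₂) * l * U := by
    have e : regret M H K δ η D h n ≤ ∑ k ∈ Finset.Icc 1 n,
        (value M H (polK H K δ η D k) 1 (D.state k 1) - optValue M H 1 (D.state k 1))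
        + ∑ j ∈ Finset.Ico 1 h, ∑ k ∈ Finset.Icc 1 n,
          stepNoise M D (polK H K δ η D k) (gapFn M H K δ η D k j) k j := by
      rw [Finset.sum_comm, ← Finset.sum_add_distrib]
      exact Finset.sum_le_sum fun k _ =>
        value_sub_optValue_le_sum (hπ k) k h1 (show h ≤ H + 1 by omega)
    -- Passing to step `h` adds fewer than `H` noise sums of size `4 l H √n`, which the target
    -- absorbs.
    have e2 : ∑ j ∈ Finset.Ico 1 h, ∑ k ∈ Finset.Icc 1 n,
          stepNoise M D (polK H K δ η D k) (gapFn M H K δ η D k j) k j ≤ 4 * l * U := by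
      calc _ ≤ ∑ j ∈ Finset.Ico 1 h, 4 * l * H * √n := by
            refine Finset.sum_le_sum fun j hj => ?_
            rw [Finset.mem_Ico] at hj
            exact hnoise' j hj.1 (by omega)
        _ ≤ H * (4 * l * H * √n) := by
            rw [Finset.sum_const, nsmul_eq_mul, Nat.card_Ico]
            refine mul_le_mul_of_nonneg_right ?_ (by positivity)
            exact_mod_cast (show h - 1 ≤ H by omega)
        _ = 4 * l * ((H : ℝ) ^ 2 * √n) := by ring
        _ ≤ 4 * l * U := by gcongr
    linarith
  have hlU : 0 ≤ l * U := by positivity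
  refine ⟨by linarith, ?_⟩
  have habs : ∑ k ∈ Finset.Icc 1 n, |VK H K δ η D k h (D.state k h) - optValue M H h (D.state k h)|
      ≤ regret M H K δ η D h n + ∑ k ∈ Finset.Icc 1 n,
        (value M H (polK H K δ η D k) h (D.state k h) - VK H K δ η D k h (D.state k h)) := by
    rw [regret, ← Finset.sum_add_distrib]
    refine Finset.sum_le_sum fun k hk => ?_
    rw [Finset.mem_Icc] at hk
    have hle := optValue_le_value M (hπ k) (show h ≤ H + 1 by omega) (D.state k h)
    have hge := (value_sub_VK_mem hopt hk.1 (hk.2.trans hnK)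
      (fun h _ _ s a => bK_le_bonusCap hH hK hδ hδ1 k h s a)
      (fun h s a => bonusCap_nonneg hH hK hδ hδ1 k h s a)
      (show h ≤ H + 1 by omega) h1 (D.state k h)).1
    rw [abs_le]
    constructor <;> linarith
  -- The constants add up to `76 + 72 = 148 ≤ 150`.
  linarith [hV h h1 hh]

end Algorithm

/-! ### Measurability of the iterates -/

section Measurability

variable {𝒮 𝒜 : Type*} [Fintype 𝒮] [DecidableEq 𝒮] [Fintype 𝒜] [DecidableEq 𝒜]
variable {Ω : Type*}

/-- The data of episodes `1, …, k` are measurable. -/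
structure Observed [MeasurableSpace Ω] (H : ℕ) (X : Ω → Record 𝒮 𝒜) (k : ℕ) : Prop where
  state : ∀ i j, 1 ≤ i → i ≤ k → 1 ≤ j → j ≤ H → ∀ x, MeasurableSet {ω | (X ω).state i j = x}
  act : ∀ i j, 1 ≤ i → i ≤ k → 1 ≤ j → j ≤ H → ∀ x, MeasurableSet {ω | (X ω).act i j = x}
  cost : ∀ i j, 1 ≤ i → i ≤ k → 1 ≤ j → j ≤ H → Measurable fun ω => (X ω).cost i j
  next : ∀ i j, 1 ≤ i → i ≤ k → 1 ≤ j → j ≤ H →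
    ∀ x, MeasurableSet {ω | (X ω).state i (j + 1) = x}

variable {mΩ : MeasurableSpace Ω} {H K : ℕ} {δ : ℝ} {X : Ω → Record 𝒮 𝒜} {n : ℕ}

theorem Observed.mono (hX : Observed H X n) {k : ℕ} (hk : k ≤ n) : Observed H X k where
  state i j hi hik := hX.state i j hi (hik.trans hk)
  act i j hi hik := hX.act i j hi (hik.trans hk)
  cost i j hi hik := hX.cost i j hi (hik.trans hk)
  next i j hi hik := hX.next i j hi (hik.trans hk)

theorem measurable_card_filter (s : Finset ℕ) {p : Ω → ℕ → Prop} [∀ ω, DecidablePred (p ω)]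
    (hp : ∀ i ∈ s, MeasurableSet {ω | p ω i}) :
    Measurable fun ω => (((s.filter (p ω)).card : ℕ) : ℝ) := by
  classical
  simp only [Finset.card_filter, Nat.cast_sum]
  refine Finset.measurable_sum _ fun i hi => ?_
  simp only [Nat.cast_ite, Nat.cast_one, Nat.cast_zero]
  exact Measurable.ite (hp i hi) measurable_const measurable_const

variable {h : ℕ}

theorem Observed.measurable_visits (hX : Observed H X n) (h1 : 1 ≤ h) (hh : h ≤ H) (s : 𝒮) :
    Measurable fun ω => (visits (X ω) n h s : ℝ) := by
  refine measurable_card_filter _ fun i hi => ?_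
  rw [Finset.mem_Icc] at hi
  exact hX.state i h hi.1 hi.2 h1 hh s

theorem Observed.measurable_visitsSA (hX : Observed H X n) (h1 : 1 ≤ h) (hh : h ≤ H) (s : 𝒮) (a : 𝒜) :
    Measurable fun ω => (visitsSA (X ω) n h s a : ℝ) := by
  refine measurable_card_filter _ fun i hi => ?_
  rw [Finset.mem_Icc] at hi
  exact (hX.state i h hi.1 hi.2 h1 hh s).inter (hX.act i h hi.1 hi.2 h1 hh a)

theorem Observed.measurable_visitsSAS (hX : Observed H X n) (h1 : 1 ≤ h) (hh : h ≤ H) (s : 𝒮) (a : 𝒜)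
    (y : 𝒮) : Measurable fun ω => (visitsSAS (X ω) n h s a y : ℝ) := by
  refine measurable_card_filter _ fun i hi => ?_
  rw [Finset.mem_Icc] at hi
  exact (hX.state i h hi.1 hi.2 h1 hh s).inter
    ((hX.act i h hi.1 hi.2 h1 hh a).inter (hX.next i h hi.1 hi.2 h1 hh y))

theorem Observed.measurable_cnt (hX : Observed H X n) (h1 : 1 ≤ h) (hh : h ≤ H) (s : 𝒮) (a : 𝒜) :
    Measurable fun ω => cnt (X ω) n h s a :=
  (hX.measurable_visitsSA h1 hh s a).max measurable_const

theorem Observed.measurable_cbar (hX : Observed H X n) (h1 : 1 ≤ h) (hh : h ≤ H) (s : 𝒮) (a : 𝒜) :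
    Measurable fun ω => cbar (X ω) n h s a := by
  refine Measurable.div ?_ (hX.measurable_cnt h1 hh s a)
  simp only [Finset.sum_filter]
  refine Finset.measurable_sum _ fun i hi => ?_
  rw [Finset.mem_Icc] at hi
  exact Measurable.ite ((hX.state i h hi.1 hi.2 h1 hh s).inter (hX.act i h hi.1 hi.2 h1 hh a))
    (hX.cost i h hi.1 hi.2 h1 hh) measurable_const

theorem Observed.measurable_Pbar (hX : Observed H X n) (h1 : 1 ≤ h) (hh : h ≤ H) (s : 𝒮) (a : 𝒜) (y : 𝒮) :
    Measurable fun ω => Pbar (X ω) n h s a y :=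
  (hX.measurable_visitsSAS h1 hh s a y).div (hX.measurable_cnt h1 hh s a)

theorem Observed.measurable_bonus (hX : Observed H X n) (h1 : 1 ≤ h) (hh : h ≤ H) {Vref V : Ω → 𝒮 → ℝ}
    (hVref : ∀ y, Measurable fun ω => Vref ω y) (hV : ∀ y, Measurable fun ω => V ω y)
    (s : 𝒮) (a : 𝒜) :
    Measurable fun ω => bonus H K δ (X ω) (Vref ω) (V ω) n h s a := by
  have m1 := hX.measurable_visitsSA h1 hh s a
  have m2 := hX.measurable_cnt h1 hh s a
  have m3 := fun y => hX.measurable_Pbar h1 hh s a y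
  unfold bonus uBonus
  dsimp only
  generalize hN : (fun ω => (visitsSA (X ω) n h s a : ℝ)) = N at m1
  generalize hC : (fun ω => cnt (X ω) n h s a) = C at m2
  generalize hp : (fun y ω => Pbar (X ω) n h s a y) = p
  replace m3 : ∀ y, Measurable (p y) := fun y => hp ▸ m3 y
  simp only [show ∀ ω, (visitsSA (X ω) n h s a : ℝ) = N ω from congrFun hN,
    show ∀ ω, cnt (X ω) n h s a = C ω from congrFun hC,
    show ∀ y ω, Pbar (X ω) n h s a y = p y ω from fun y => congrFun (congrFun hp y)]
  fun_prop

theorem Observed.measurable_qBackup (hX : Observed H X n) (h1 : 1 ≤ h) (hh : h ≤ H)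
    {st : Ω → AlgState 𝒮 𝒜} (hvref : ∀ h s, Measurable fun ω => (st ω).vref h s)
    {V : Ω → 𝒮 → ℝ} (hV : ∀ y, Measurable fun ω => V ω y) (s : 𝒮) (a : 𝒜) :
    Measurable fun ω => qBackup H K δ (X ω) (st ω) n h (V ω) s a := by
  have m1 := hX.measurable_cbar h1 hh s a
  have m2 := fun y => hX.measurable_Pbar h1 hh s a y
  have m3 := hX.measurable_bonus (K := K) (δ := δ) h1 hh (fun y => hvref (h + 1) y) hV s a
  unfold qBackup
  fun_prop

theorem Observed.measurable_vBackward (hX : Observed H X n) {st : Ω → AlgState 𝒮 𝒜}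
    (hpol : ∀ h s a, 1 ≤ h → h ≤ H → Measurable fun ω => (st ω).pol h s a)
    (hvref : ∀ h s, Measurable fun ω => (st ω).vref h s) (j : ℕ) (hj : j ≤ H) (s : 𝒮) :
    Measurable fun ω => vBackward H K δ (X ω) (st ω) n j s := by
  induction j generalizing s with
  | zero => exact measurable_const
  | succ j ih =>
    refine Finset.measurable_sum _ fun a _ => Measurable.mul ?_ (hpol _ _ _ (by omega) (by omega))
    exact hX.measurable_qBackup (by omega) (by omega) hvref (fun y => ih (by omega) y) s a

theorem Observed.measurable_vEst (hX : Observed H X n) {st : Ω → AlgState 𝒮 𝒜}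
    (hpol : ∀ h s a, 1 ≤ h → h ≤ H → Measurable fun ω => (st ω).pol h s a)
    (hvref : ∀ h s, Measurable fun ω => (st ω).vref h s) (h1 : 1 ≤ h) (s : 𝒮) :
    Measurable fun ω => vEst H K δ (X ω) (st ω) n h s :=
  hX.measurable_vBackward hpol hvref _ (by omega) s

variable [Nonempty 𝒜] {η : ℕ → ℝ}

/-- The policies and value histories are claimed only at steps `1, …, H`, where data are observed.
The reference values are claimed at every step, since the bonus at step `H` reads index `H + 1`;
there they keep their initial value. -/
theorem Observed.measurable_stateAfter (hX : Observed H X n) :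
    (∀ h s a, 1 ≤ h → h ≤ H → Measurable fun ω => (stateAfter H K δ η (X ω) n).pol h s a) ∧
    (∀ h s, Measurable fun ω => (stateAfter H K δ η (X ω) n).vref h s) ∧
    (∀ i h s, 1 ≤ h → h ≤ H →
      Measurable fun ω => (stateAfter H K δ η (X ω) n).vhist i h s) := by
  induction n with
  | zero => exact ⟨fun _ _ _ _ _ => measurable_const, fun _ _ => measurable_const,
      fun _ _ _ _ _ => measurable_const⟩
  | succ n ih =>
    obtain ⟨hpol, hvref, hvhist⟩ := ih (hX.mono (Nat.le_succ n))
    have hV := fun h (h1 : 1 ≤ h) s => hX.measurable_vEst (K := K) (δ := δ) hpol hvref h1 s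
    have hvhist' : ∀ i h s, 1 ≤ h → h ≤ H →
        Measurable fun ω => (stateAfter H K δ η (X ω) (n + 1)).vhist i h s := by
      intro i h s h1 hh
      by_cases hi : i = n + 1
      · subst hi
        simp only [stateAfter, algStep, Function.update_self]
        exact hV h h1 s
      · simp only [stateAfter, algStep, Function.update_of_ne hi]
        exact hvhist i h s h1 hh
    refine ⟨fun h s a h1 hh => ?_, fun h s => ?_, hvhist'⟩
    · have hq : Measurable fun ω => qEst H K δ (X ω) (stateAfter H K δ η (X ω) n) (n + 1) h s :=
        measurable_pi_iff.2 fun a => hX.measurable_qBackup h1 hh hvref (fun y => hV (h + 1) (by omega) y) s a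
      have hp : Measurable fun ω => (stateAfter H K δ η (X ω) n).pol h s :=
        measurable_pi_iff.2 fun a => hpol h s a h1 hh
      have hm := (continuous_mirrorStep (𝒜 := 𝒜) (η (n + 1))).measurable.comp (hq.prodMk hp)
      exact measurable_pi_iff.1 hm a
    · by_cases hc : 1 ≤ h ∧ h ≤ H
      · have hv := hX.measurable_visits hc.1 hc.2 s
        -- Under the indicator the visited state is `s`, so the history can be evaluated at a fixed
        -- state.
        have e : (fun ω => (stateAfter H K δ η (X ω) (n + 1)).vref h s) = fun ω =>
            if C₀ 𝒮 𝒜 H * √((n + 1 : ℕ) : ℝ) ≤ (visits (X ω) (n + 1) h s : ℝ) then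
              (1 / (visits (X ω) (n + 1) h s : ℝ)) * ∑ i ∈ Finset.Icc 1 (n + 1),
                if (X ω).state i h = s then (stateAfter H K δ η (X ω) (n + 1)).vhist i h s else 0
            else (stateAfter H K δ η (X ω) n).vref h s := by
          funext ω
          rw [stateAfter]
          simp only [algStep, hc.1, hc.2, true_and]
          congr 2
          refine Finset.sum_congr rfl fun i _ => ?_
          split_ifs with hs
          · rw [hs]
          · rfl
        rw [e]
        have hsum : Measurable fun ω => ∑ i ∈ Finset.Icc 1 (n + 1),
            if (X ω).state i h = s then (stateAfter H K δ η (X ω) (n + 1)).vhist i h s else 0 := by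
          refine Finset.measurable_sum _ fun i hi => ?_
          rw [Finset.mem_Icc] at hi
          exact Measurable.ite (hX.state i h hi.1 hi.2 hc.1 hc.2 s) (hvhist' i h s hc.1 hc.2)
            measurable_const
        exact Measurable.ite (measurableSet_le measurable_const hv)
          ((measurable_const.div hv).mul hsum) (hvref h s)
      · have e : (fun ω => (stateAfter H K δ η (X ω) (n + 1)).vref h s)
            = fun ω => (stateAfter H K δ η (X ω) n).vref h s := by
          funext ω
          exact if_neg fun hc' => hc ⟨hc'.1, hc'.2.1⟩
        rw [e]
        exact hvref h s

variable {k : ℕ}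

theorem Observed.measurable_polK (hX : Observed H X (k - 1)) (h1 : 1 ≤ h) (hh : h ≤ H) (s : 𝒮) (a : 𝒜) :
    Measurable fun ω => polK H K δ η (X ω) k h s a :=
  hX.measurable_stateAfter.1 h s a h1 hh

theorem Observed.measurable_value (hX : Observed H X (k - 1)) (M : MDP 𝒮 𝒜) (h1 : 1 ≤ h) (hh : h ≤ H + 1) :
    ∀ s, Measurable fun ω => value M H (polK H K δ η (X ω) k) h s := by
  refine backward_induction (H := H) (p := fun h => 1 ≤ h → ∀ s, Measurable fun ω =>
    value M H (polK H K δ η (X ω) k) h s) ?_ ?_ hh h1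
  · intro _ s
    simp only [value_eq_zero M (show H < H + 1 by omega)]
    exact measurable_const
  · intro h hh ih h1 s
    simp only [value_bellman M (polK_mem H K δ η _ k) hh]
    have m1 := fun a => hX.measurable_polK (K := K) (δ := δ) (η := η) h1 hh s a
    have m2 := ih (by omega)
    exact Finset.measurable_sum _ fun a _ => (m1 a).mul
      (measurable_const.add (Finset.measurable_sum _ fun y _ => measurable_const.mul (m2 y)))

theorem Observed.measurable_bonusCap (hX : Observed H X (k - 1)) (h1 : 1 ≤ h) (hh : h ≤ H) (s : 𝒮) (a : 𝒜) :
    Measurable fun ω => bonusCap H K δ (X ω) k h s a :=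
  measurable_const.mul (measurable_const.div
    ((hX.measurable_visitsSA h1 hh s a).max measurable_const).sqrt)

theorem Observed.measurable_width (hX : Observed H X (k - 1)) (M : MDP 𝒮 𝒜) (h1 : 1 ≤ h) (hh : h ≤ H + 1) :
    ∀ s, Measurable fun ω => width M H (polK H K δ η (X ω) k)
      (fun h s a => min (bonusCap H K δ (X ω) k h s a) H) h s := by
  refine backward_induction (H := H) (p := fun h => 1 ≤ h → ∀ s, Measurable fun ω =>
    width M H (polK H K δ η (X ω) k)
      (fun h s a => min (bonusCap H K δ (X ω) k h s a) H) h s) ?_ ?_ hh h1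
  · intro _ s
    simp only [width_top]
    exact measurable_const
  · intro h hh ih h1 s
    simp only [width_eq M hh]
    have m1 := fun a => hX.measurable_polK (K := K) (δ := δ) (η := η) h1 hh s a
    have m2 := ih (by omega)
    have m3 := fun a => hX.measurable_bonusCap (K := K) (δ := δ) h1 hh s a
    exact measurable_const.min (Finset.measurable_sum _ fun a _ => (m1 a).mul
      (Finset.measurable_sum _ fun y _ => measurable_const.mul
        ((measurable_const.mul ((m3 a).min measurable_const)).add (m2 y))))

/-- A function of the current state is measurable if each of its sections is. -/
theorem measurable_of_state {f : Ω → 𝒮 → ℝ} (hf : ∀ s, Measurable fun ω => f ω s) {x : Ω → 𝒮}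
    (hx : ∀ s, MeasurableSet {ω | x ω = s}) : Measurable fun ω => f ω (x ω) := by
  have e : (fun ω => f ω (x ω)) = fun ω => ∑ s, if x ω = s then f ω s else 0 := by
    funext ω
    simp
  rw [e]
  exact Finset.measurable_sum _ fun s _ => Measurable.ite (hx s) (hf s) measurable_const

theorem Observed.measurable_widthFn (hX : Observed H X (k - 1)) (M : MDP 𝒮 𝒜) (h1 : 1 ≤ h) (hh : h ≤ H)
    (hs : ∀ s, MeasurableSet {ω | (X ω).state k h = s}) (a : 𝒜) (y : 𝒮) :
    Measurable fun ω => widthFn M H K δ η (X ω) k h a y := by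
  have m1 := measurable_of_state (fun s => hX.measurable_bonusCap (K := K) (δ := δ) h1 hh s a) hs
  have m2 := hX.measurable_width (K := K) (δ := δ) (η := η) M (show 1 ≤ h + 1 by omega) (by omega) y
  exact ((measurable_const.mul (m1.min measurable_const)).add m2).neg

theorem Observed.measurable_gapFn (hX : Observed H X (k - 1)) (M : MDP 𝒮 𝒜) (hh : h ≤ H)
    (a : 𝒜) (y : 𝒮) : Measurable fun ω => gapFn M H K δ η (X ω) k h a y :=
  (hX.measurable_value M (by omega) (by omega) y).sub measurable_const

theorem Observed.measurable_stepAvg (hX : Observed H X (k - 1)) (M : MDP 𝒮 𝒜) (h1 : 1 ≤ h) (hh : h ≤ H)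
    (hs : ∀ s, MeasurableSet {ω | (X ω).state k h = s}) {g : Ω → 𝒜 → 𝒮 → ℝ}
    (hg : ∀ a y, Measurable fun ω => g ω a y) :
    Measurable fun ω => stepAvg M (polK H K δ η (X ω) k) h ((X ω).state k h) (g ω) := by
  refine measurable_of_state (f := fun ω s => stepAvg M (polK H K δ η (X ω) k) h s
    (g ω)) (fun s => ?_) hs
  exact Finset.measurable_sum _ fun a _ => (hX.measurable_polK h1 hh s a).mul
    (Finset.measurable_sum _ fun y _ => measurable_const.mul (hg a y))

end Measurability

/-! ### Concentration -/

section Concentration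

/-- Hoeffding's lemma for a finitely supported distribution. -/
theorem simplex_exp_le {ι : Type*} [Fintype ι] {w x : ι → ℝ} (hw : w ∈ stdSimplex ℝ ι) {b : ℝ}
    (hb : 0 < b) (hx : ∀ i, |x i| ≤ b) (hmean : ∑ i, w i * x i = 0) (t : ℝ) :
    ∑ i, w i * Real.exp (t * x i) ≤ Real.exp ((t * b) ^ 2 / 2) := by
  -- By convexity the exponential lies below its chord on `[-b, b]`; the linear part has mean zero.
  have h1 : ∀ i, Real.exp (t * x i) ≤ Real.cosh (t * b) + x i / b * Real.sinh (t * b) := by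
    intro i
    have h := Real.exp_mul_le_cosh_add_mul_sinh (t := x i / b) (by
      rw [abs_div, abs_of_pos hb]
      exact (div_le_one hb).2 (hx i)) (t * b)
    rwa [show x i / b * (t * b) = t * x i by field_simp] at h
  calc ∑ i, w i * Real.exp (t * x i)
      ≤ ∑ i, w i * (Real.cosh (t * b) + x i / b * Real.sinh (t * b)) := simplex_sum_mono hw h1
    _ = (∑ i, w i) * Real.cosh (t * b) + (∑ i, w i * x i) * (Real.sinh (t * b) / b) := by
        rw [Finset.sum_mul, Finset.sum_mul, ← Finset.sum_add_distrib]
        exact Finset.sum_congr rfl fun i _ => by ring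
    _ = Real.cosh (t * b) := by rw [hw.2, hmean]; ring
    _ ≤ _ := Real.cosh_le_exp_half_sq _

theorem integral_mul_eq_of_condExp {Ω : Type*} {m mΩ : MeasurableSpace Ω} {μ : Measure Ω}
    [IsFiniteMeasure μ] (hm : m ≤ mΩ) {f g Z : Ω → ℝ} (hf : Integrable f μ)
    (hfg : μ[f | m] =ᵐ[μ] g) (hZ : Measurable[m] Z) {C : ℝ} (hC : ∀ ω, |Z ω| ≤ C) :
    ∫ ω, f ω * Z ω ∂μ = ∫ ω, g ω * Z ω ∂μ := by
  have hZ' : StronglyMeasurable[m] Z := hZ.stronglyMeasurable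
  have hint : Integrable (f * Z) μ :=
    hf.mul_bdd (c := C) (hZ.mono hm le_rfl).aestronglyMeasurable (Filter.Eventually.of_forall hC)
  have h1 := condExp_mul_of_stronglyMeasurable_right hZ' hint hf
  calc ∫ ω, f ω * Z ω ∂μ = ∫ ω, (μ[f * Z | m]) ω ∂μ := (integral_condExp hm).symm
    _ = ∫ ω, (μ[f | m]) ω * Z ω ∂μ := integral_congr_ae h1
    _ = ∫ ω, g ω * Z ω ∂μ := integral_congr_ae (hfg.mono fun ω h => by simp [h])

variable {𝒮 𝒜 : Type*} [Fintype 𝒮] [DecidableEq 𝒮] [Fintype 𝒜] [DecidableEq 𝒜]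

theorem comap_top_le {Ω α : Type*} [Finite α] {m : MeasurableSpace Ω} {f : Ω → α}
    (hf : ∀ x, MeasurableSet {ω | f ω = x}) : MeasurableSpace.comap f ⊤ ≤ m := by
  rintro _ ⟨t, -, rfl⟩
  rw [← Set.biUnion_preimage_singleton]
  exact t.toFinite.measurableSet_biUnion fun x _ => hf x

theorem measurableSet_eq_of_comap_le {Ω α : Type*} {m : MeasurableSpace Ω} {f : Ω → α}
    (hf : MeasurableSpace.comap f ⊤ ≤ m) (x : α) : MeasurableSet {ω | f ω = x} :=
  hf _ ⟨{x}, trivial, rfl⟩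

/-! ### The filtration of the interaction. -/

section History

variable {Ω : Type*} {H : ℕ} {X : Ω → Record 𝒮 𝒜} {k h : ℕ}

theorem le_histState {i j : ℕ} (hi : 1 ≤ i) (hj : 1 ≤ j) (hjH : j ≤ H)
    (hij : i < k ∨ i = k ∧ j < h) :
    MeasurableSpace.comap (fun ω => (X ω).state i j) ⊤ ⊔
      MeasurableSpace.comap (fun ω => (X ω).act i j) ⊤ ⊔
      MeasurableSpace.comap (fun ω => (X ω).cost i j) (borel ℝ) ⊔
      MeasurableSpace.comap (fun ω => (X ω).state i (j + 1)) ⊤ ≤ histState H X k h :=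
  le_sup_of_le_left (le_iSup_of_le i (le_iSup_of_le j (le_iSup_of_le ⟨hi, hj, hjH, hij⟩ le_rfl)))

theorem measurableSet_state_histState (s : 𝒮) :
    MeasurableSet[histState H X k h] {ω | (X ω).state k h = s} :=
  measurableSet_eq_of_comap_le le_sup_right s

/-- Instantiates the measurability results at the history itself instead of the ambient σ-algebra,
which makes the iterates of episode `k` predictable. -/
theorem observed_histState : @Observed 𝒮 𝒜 Ω (histState H X k h) H X (k - 1) := by
  refine @Observed.mk 𝒮 𝒜 Ω (histState H X k h) H X (k - 1) ?_ ?_ ?_ ?_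
  · intro i j hi hik hj hjH
    exact measurableSet_eq_of_comap_le ((le_sup_left.trans (le_sup_left.trans le_sup_left)).trans
      (le_histState hi hj hjH (Or.inl (by omega))))
  · intro i j hi hik hj hjH
    exact measurableSet_eq_of_comap_le ((le_sup_right.trans (le_sup_left.trans le_sup_left)).trans
      (le_histState hi hj hjH (Or.inl (by omega))))
  · intro i j hi hik hj hjH
    have h1 := (le_sup_right.trans le_sup_left).trans
      (le_histState (X := X) (h := h) hi hj hjH (Or.inl (show i < k by omega)))
    intro B hB
    refine h1 _ ⟨B, ?_, rfl⟩
    rwa [← BorelSpace.measurable_eq (α := ℝ)]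
  · intro i j hi hik hj hjH
    exact measurableSet_eq_of_comap_le (le_sup_right.trans
      (le_histState hi hj hjH (Or.inl (by omega))))

theorem histState_le_succ (hk : 1 ≤ k) (h1 : 1 ≤ h) (hh : h ≤ H) :
    histState H X k h ≤ histState H X (k + 1) h := by
  refine sup_le (iSup_le fun i => iSup_le fun j => iSup_le fun hij => ?_) ?_
  · exact le_histState hij.1 hij.2.1 hij.2.2.1 (Or.inl (by omega))
  · exact (le_sup_left.trans (le_sup_left.trans le_sup_left)).trans
      (le_histState hk h1 hh (Or.inl (by omega)))

end History

variable [Nonempty 𝒜] {Ω : Type*} {mΩ : MeasurableSpace Ω} {μ : Measure Ω}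
  [IsProbabilityMeasure μ] {M : MDP 𝒮 𝒜} {H K : ℕ} {δ : ℝ} {η : ℕ → ℝ} {s₁ : 𝒮}
  {X : Ω → Record 𝒮 𝒜}

theorem IsRun.comap_cost_le (hX : IsRun M H K δ η s₁ μ X) (i j : ℕ) :
    MeasurableSpace.comap (fun ω => (X ω).cost i j) (borel ℝ) ≤ mΩ := by
  rw [← BorelSpace.measurable_eq (α := ℝ)]
  exact (hX.measurable_cost i j).comap_le

theorem IsRun.histState_le (hX : IsRun M H K δ η s₁ μ X) (k h : ℕ) : histState H X k h ≤ mΩ := by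
  have hs := fun i j => comap_top_le (hX.measurable_state i j)
  have ha := fun i j => comap_top_le (hX.measurable_act i j)
  refine sup_le (iSup_le fun i => iSup_le fun j => iSup_le fun _ => ?_) (hs k h)
  exact sup_le (sup_le (sup_le (hs i j) (ha i j)) (hX.comap_cost_le i j)) (hs i (j + 1))

theorem IsRun.histAct_le (hX : IsRun M H K δ η s₁ μ X) (k h : ℕ) : histAct H X k h ≤ mΩ :=
  sup_le (hX.histState_le k h) (comap_top_le (hX.measurable_act k h))

theorem IsRun.histCost_le (hX : IsRun M H K δ η s₁ μ X) (k h : ℕ) : histCost H X k h ≤ mΩ :=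
  sup_le (hX.histAct_le k h) (hX.comap_cost_le k h)

theorem integrable_of_abs_le {Z : Ω → ℝ} (hZ : Measurable Z) {C : ℝ} (hC : ∀ ω, |Z ω| ≤ C) :
    Integrable Z μ :=
  Integrable.of_bound hZ.aestronglyMeasurable C (Filter.Eventually.of_forall hC)

/-- Condition twice: first the next state given the information after the cost, which contains the
action, then the action given the past and the current state. On the event that the action is `a`,
the transition probability is that of `a`, so it can be pulled out of the second conditioning. -/
theorem IsRun.integral_indicator (hX : IsRun M H K δ η s₁ μ X) {k h : ℕ} (hk : 1 ≤ k)
    (hkK : k ≤ K) (h1 : 1 ≤ h) (hh : h ≤ H) (a : 𝒜) (y : 𝒮) {Z : Ω → ℝ}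
    (hZ : Measurable[histState H X k h] Z) {C : ℝ} (hC : ∀ ω, |Z ω| ≤ C) :
    ∫ ω, Set.indicator {ω | (X ω).state k (h + 1) = y} (fun _ => (1 : ℝ)) ω
        * (Set.indicator {ω | (X ω).act k h = a} (fun _ => (1 : ℝ)) ω * Z ω) ∂μ
      = ∫ ω, polK H K δ η (X ω) k h ((X ω).state k h) a * (M.P h ((X ω).state k h) a y * Z ω) ∂μ := by
  have hC0 : 0 ≤ C := by
    obtain ⟨ω⟩ := μ.nonempty_of_neZero
    exact (abs_nonneg _).trans (hC ω)
  have hP : Measurable[histState H X k h] fun ω => M.P h ((X ω).state k h) a y :=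
    @measurable_of_state 𝒮 _ _ Ω (histState H X k h) (fun _ s => M.P h s a y)
      (fun s => @measurable_const _ _ _ (histState H X k h) _) (fun ω => (X ω).state k h)
      fun s => measurableSet_state_histState s
  have hact : Measurable[histCost H X k h]
      (Set.indicator {ω | (X ω).act k h = a} (fun _ => (1 : ℝ))) :=
    (@measurable_const _ _ _ (histCost H X k h) _).indicator
      (measurableSet_eq_of_comap_le (le_sup_right.trans le_sup_left) a)
  have hZ' : Measurable[histCost H X k h] Z := hZ.mono (le_sup_left.trans le_sup_left) le_rfl
  have hbd : ∀ ω, |Set.indicator {ω | (X ω).act k h = a} (fun _ => (1 : ℝ)) ω * Z ω| ≤ C := by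
    intro ω
    by_cases hω : (X ω).act k h = a
    · simpa [Set.indicator, hω] using hC ω
    · simpa [Set.indicator, hω] using hC0
  have e1 := integral_mul_eq_of_condExp (hX.histCost_le k h)
    ((integrable_const (1 : ℝ)).indicator (hX.measurable_state k (h + 1) y))
    (hX.state_law k h hk hkK h1 hh y) (hact.mul hZ') hbd
  have hbd' : ∀ ω, |M.P h ((X ω).state k h) a y * Z ω| ≤ C := by
    intro ω
    rw [abs_mul, abs_of_nonneg ((M.P_mem _ _ _).1 y)]
    exact (mul_le_of_le_one_left (abs_nonneg _) (simplex_le_one (M.P_mem _ _ _) y)).trans (hC ω)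
  have e2 := integral_mul_eq_of_condExp (hX.histState_le k h)
    ((integrable_const (1 : ℝ)).indicator (hX.measurable_act k h a))
    (hX.act_law k h hk hkK h1 hh a) (hP.mul hZ) hbd'
  refine e1.trans (Eq.trans ?_ e2)
  refine integral_congr_ae (Filter.Eventually.of_forall fun ω => ?_)
  by_cases hω : (X ω).act k h = a
  · simp [Set.indicator, hω]
  · simp [Set.indicator, hω]

/-- Averaging over the action and the next state given the past. -/
theorem IsRun.integral_step (hX : IsRun M H K δ η s₁ μ X) {k h : ℕ} (hk : 1 ≤ k)
    (hkK : k ≤ K) (h1 : 1 ≤ h) (hh : h ≤ H) {Z : Ω → 𝒜 → 𝒮 → ℝ}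
    (hZ : ∀ a y, Measurable[histState H X k h] fun ω => Z ω a y) {C : ℝ}
    (hC : ∀ ω a y, |Z ω a y| ≤ C) :
    ∫ ω, Z ω ((X ω).act k h) ((X ω).state k (h + 1)) ∂μ
      = ∫ ω, stepAvg M (polK H K δ η (X ω) k) h ((X ω).state k h) (Z ω) ∂μ := by
  have hZm : ∀ a y, Measurable fun ω => Z ω a y := fun a y =>
    (hZ a y).mono (hX.histState_le k h) le_rfl
  have hobs := observed_histState (H := H) (X := X) (k := k) (h := h)
  have hint : ∀ a y, Integrable (fun ω =>
      Set.indicator {ω | (X ω).state k (h + 1) = y} (fun _ => (1 : ℝ)) ω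
        * (Set.indicator {ω | (X ω).act k h = a} (fun _ => (1 : ℝ)) ω * Z ω a y)) μ := by
    intro a y
    refine integrable_of_abs_le (C := C) ((measurable_const.indicator
      (hX.measurable_state k (h + 1) y)).mul ((measurable_const.indicator
      (hX.measurable_act k h a)).mul (hZm a y))) fun ω => ?_
    have h0 : 0 ≤ C := (abs_nonneg _).trans (hC ω a y)
    simp only [Set.indicator]
    split_ifs <;> simp [hC ω a y, h0]
  have hint' : ∀ a y, Integrable (fun ω => polK H K δ η (X ω) k h ((X ω).state k h) a
      * (M.P h ((X ω).state k h) a y * Z ω a y)) μ := by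
    intro a y
    have m1 : Measurable fun ω => polK H K δ η (X ω) k h ((X ω).state k h) a :=
      (@measurable_of_state 𝒮 _ _ Ω (histState H X k h)
        (fun ω s => polK H K δ η (X ω) k h s a)
        (fun s => hobs.measurable_polK h1 hh s a) (fun ω => (X ω).state k h)
        fun s => measurableSet_state_histState s).mono (hX.histState_le k h) le_rfl
    have m2 : Measurable fun ω => M.P h ((X ω).state k h) a y :=
      measurable_of_state (f := fun _ s => M.P h s a y) (fun _ => measurable_const)
        (hX.measurable_state k h)
    refine integrable_of_abs_le (C := C) (m1.mul (m2.mul (hZm a y))) fun ω => ?_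
    rw [abs_mul, abs_mul, abs_of_nonneg ((M.P_mem _ _ _).1 y),
      abs_of_nonneg ((polK_mem H K δ η (X ω) k h _).1 a)]
    exact (mul_le_of_le_one_left (by
        have := (M.P_mem h ((X ω).state k h) a).1 y
        positivity) (simplex_le_one (polK_mem H K δ η (X ω) k h _) a)).trans
      ((mul_le_of_le_one_left (abs_nonneg _) (simplex_le_one (M.P_mem _ _ _) y)).trans (hC ω a y))
  calc ∫ ω, Z ω ((X ω).act k h) ((X ω).state k (h + 1)) ∂μ
      = ∫ ω, ∑ a, ∑ y, Set.indicator {ω | (X ω).state k (h + 1) = y} (fun _ => (1 : ℝ)) ω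
        * (Set.indicator {ω | (X ω).act k h = a} (fun _ => (1 : ℝ)) ω * Z ω a y) ∂μ := by
        -- Exactly one pair of indicators is nonzero, so the double sum is the value at the realised
        -- action and next state.
        congr 1
        funext ω
        simp [Set.indicator]
    _ = ∑ a, ∑ y, ∫ ω, Set.indicator {ω | (X ω).state k (h + 1) = y} (fun _ => (1 : ℝ)) ω
        * (Set.indicator {ω | (X ω).act k h = a} (fun _ => (1 : ℝ)) ω * Z ω a y) ∂μ := by
        rw [integral_finsetSum _ fun a _ => integrable_finsetSum _ fun y _ => hint a y]
        exact Finset.sum_congr rfl fun a _ => integral_finsetSum _ fun y _ => hint a y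
    _ = ∑ a, ∑ y, ∫ ω, polK H K δ η (X ω) k h ((X ω).state k h) a
        * (M.P h ((X ω).state k h) a y * Z ω a y) ∂μ :=
        Finset.sum_congr rfl fun a _ => Finset.sum_congr rfl fun y _ =>
          hX.integral_indicator hk hkK h1 hh a y (hZ a y) fun ω => hC ω a y
    _ = ∫ ω, ∑ a, ∑ y, polK H K δ η (X ω) k h ((X ω).state k h) a
        * (M.P h ((X ω).state k h) a y * Z ω a y) ∂μ := by
        rw [integral_finsetSum _ fun a _ => integrable_finsetSum _ fun y _ => hint' a y]
        exact (Finset.sum_congr rfl fun a _ => integral_finsetSum _ fun y _ => hint' a y).symm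
    _ = _ := by simp only [stepAvg, Finset.mul_sum]

/-- Hoeffding's lemma for the joint law of action and next state; centring doubles the range, so `(2
t c)² / 2 = 2 (t c)²`. -/
theorem stepAvg_exp_le {M : MDP 𝒮 𝒜} {π : ℕ → 𝒮 → 𝒜 → ℝ} {h : ℕ} {s : 𝒮}
    (hπ : π h s ∈ stdSimplex ℝ 𝒜) {g : 𝒜 → 𝒮 → ℝ} {c : ℝ} (hc : 0 < c)
    (hg : ∀ a y, |g a y| ≤ c) (t : ℝ) :
    stepAvg M π h s (fun a y => Real.exp (t * (g a y - stepAvg M π h s g)))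
      ≤ Real.exp (2 * (t * c) ^ 2) := by
  have hsum : ∀ f : 𝒜 → 𝒮 → ℝ, stepAvg M π h s f
      = ∑ z : 𝒜 × 𝒮, (π h s z.1 * M.P h s z.1 z.2) * f z.1 z.2 := by
    intro f
    rw [stepAvg, Fintype.sum_prod_type]
    simp only [Finset.mul_sum, mul_assoc]
  have hw : (fun z : 𝒜 × 𝒮 => π h s z.1 * M.P h s z.1 z.2) ∈ stdSimplex ℝ (𝒜 × 𝒮) := by
    refine ⟨fun z => mul_nonneg (hπ.1 _) ((M.P_mem _ _ _).1 _), ?_⟩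
    rw [Fintype.sum_prod_type]
    simp only [← Finset.mul_sum, (M.P_mem _ _ _).2, mul_one, hπ.2]
  set G := stepAvg M π h s g with hG
  have hG1 : G ≤ c := stepAvg_le hπ fun a y => (abs_le.1 (hg a y)).2
  have hG2 : -c ≤ G := le_stepAvg hπ fun a y => (abs_le.1 (hg a y)).1
  have hmean : ∑ z : 𝒜 × 𝒮, (π h s z.1 * M.P h s z.1 z.2) * (g z.1 z.2 - G) = 0 := by
    simp only [mul_sub, Finset.sum_sub_distrib]
    rw [← hsum, ← Finset.sum_mul, hw.2, one_mul, hG, sub_self]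
  have := simplex_exp_le hw (b := 2 * c) (by linarith) (x := fun z => g z.1 z.2 - G)
    (fun z => by
      have := abs_le.1 (hg z.1 z.2)
      exact abs_le.2 ⟨by linarith, by linarith⟩) hmean t
  rw [hsum]
  refine this.trans (le_of_eq ?_)
  congr 1
  ring

/-- The noise of step `h` in episode `k` is bounded. -/
theorem abs_stepNoise_le {D : Record 𝒮 𝒜} {π : ℕ → 𝒮 → 𝒜 → ℝ}
    (hπ : ∀ h s, π h s ∈ stdSimplex ℝ 𝒜) {g : 𝒜 → 𝒮 → ℝ} {c : ℝ} (hg : ∀ a y, |g a y| ≤ c)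
    (k h : ℕ) : |stepNoise M D π g k h| ≤ 2 * c := by
  have h1 : stepAvg M π h (D.state k h) g ≤ c :=
    stepAvg_le (hπ _ _) fun a y => (abs_le.1 (hg a y)).2
  have h2 : -c ≤ stepAvg M π h (D.state k h) g :=
    le_stepAvg (hπ _ _) fun a y => (abs_le.1 (hg a y)).1
  have h3 := abs_le.1 (hg (D.act k h) (D.state k (h + 1)))
  exact abs_le.2 ⟨by rw [stepNoise]; linarith, by rw [stepNoise]; linarith⟩

theorem measurable_stepNoise {k h : ℕ} (hk : 1 ≤ k) (h1 : 1 ≤ h) (hh : h ≤ H)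
    {g : Ω → 𝒜 → 𝒮 → ℝ} (hg : ∀ a y, Measurable[histState H X k h] fun ω => g ω a y) :
    Measurable[histState H X (k + 1) h]
      fun ω => stepNoise M (X ω) (polK H K δ η (X ω) k) (g ω) k h := by
  have hobs := observed_histState (H := H) (X := X) (k := k) (h := h)
  have hle := histState_le_succ (X := X) hk h1 hh
  have hnext := le_histState (X := X) (h := h) hk h1 hh (Or.inl (Nat.lt_succ_self k))
  have m1 := (hobs.measurable_stepAvg (K := K) (δ := δ) (η := η) M h1 hh
    (fun s => measurableSet_state_histState s) hg).mono hle le_rfl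
  have m2 : ∀ a, Measurable[histState H X (k + 1) h] fun ω => g ω a ((X ω).state k (h + 1)) :=
    fun a => @measurable_of_state 𝒮 _ _ Ω (histState H X (k + 1) h) (fun ω y => g ω a y)
      (fun y => (hg a y).mono hle le_rfl) _
      (measurableSet_eq_of_comap_le (le_sup_right.trans hnext))
  have m3 : Measurable[histState H X (k + 1) h] fun ω =>
      g ω ((X ω).act k h) ((X ω).state k (h + 1)) :=
    @measurable_of_state 𝒜 _ _ Ω (histState H X (k + 1) h)
      (fun ω a => g ω a ((X ω).state k (h + 1))) m2 _
      (measurableSet_eq_of_comap_le ((le_sup_right.trans (le_sup_left.trans le_sup_left)).trans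
        hnext))
  exact m3.sub m1

/-! ### Azuma-Hoeffding for the noise sums. -/

section Noise

variable {h : ℕ} {g : ℕ → Ω → 𝒜 → 𝒮 → ℝ} {c : ℝ}

theorem measurable_sum_stepNoise (h1 : 1 ≤ h) (hh : h ≤ H)
    (hg : ∀ k, 1 ≤ k → ∀ a y, Measurable[histState H X k h] fun ω => g k ω a y) (n : ℕ) :
    Measurable[histState H X (n + 1) h] fun ω => ∑ k ∈ Finset.Icc 1 n,
      stepNoise M (X ω) (polK H K δ η (X ω) k) (g k ω) k h := by
  induction n with
  | zero => exact @measurable_const _ _ _ (histState H X _ h) _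
  | succ n ih =>
    simp only [Finset.sum_Icc_succ_top (show 1 ≤ n + 1 by omega)]
    exact (ih.mono (histState_le_succ (by omega) h1 hh) le_rfl).add
      (measurable_stepNoise (by omega) h1 hh (hg (n + 1) (by omega)))

theorem abs_sum_stepNoise_le (hgc : ∀ k ω a y, |g k ω a y| ≤ c) (ω : Ω) (n : ℕ) :
    |∑ k ∈ Finset.Icc 1 n, stepNoise M (X ω) (polK H K δ η (X ω) k) (g k ω) k h|
      ≤ n * (2 * c) := by
  refine (Finset.abs_sum_le_sum_abs _ _).trans ?_
  calc _ ≤ ∑ k ∈ Finset.Icc 1 n, 2 * c := Finset.sum_le_sum fun k _ =>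
        abs_stepNoise_le (polK_mem H K δ η (X ω) k) (hgc k ω) k h
    _ = _ := by simp

theorem exp_mul_le {t x b : ℝ} (hx : |x| ≤ b) : |Real.exp (t * x)| ≤ Real.exp (|t| * b) := by
  rw [Real.abs_exp, Real.exp_le_exp]
  calc t * x ≤ |t * x| := le_abs_self _
    _ = |t| * |x| := abs_mul _ _
    _ ≤ |t| * b := by gcongr

/-- The exponential of the earlier sum is known before the last action is drawn; averaging over that
action and the next state costs one Hoeffding factor per episode. -/
theorem IsRun.integral_exp_sum_le (hX : IsRun M H K δ η s₁ μ X) (h1 : 1 ≤ h) (hh : h ≤ H)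
    (hg : ∀ k, 1 ≤ k → ∀ a y, Measurable[histState H X k h] fun ω => g k ω a y) (hc : 0 < c)
    (hgc : ∀ k ω a y, |g k ω a y| ≤ c) (t : ℝ) {n : ℕ} (hn : n ≤ K) :
    ∫ ω, Real.exp (t * ∑ k ∈ Finset.Icc 1 n,
        stepNoise M (X ω) (polK H K δ η (X ω) k) (g k ω) k h) ∂μ
      ≤ Real.exp (n * (2 * (t * c) ^ 2)) := by
  induction n with
  | zero => simp
  | succ n ih =>
    have ih := ih (by omega)
    have hS := measurable_sum_stepNoise (M := M) (K := K) (δ := δ) (η := η) h1 hh hg n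
    have hSb := fun ω => abs_sum_stepNoise_le (M := M) (K := K) (δ := δ) (η := η) (h := h) (X := X)
      (H := H) hgc ω n
    set S : Ω → ℝ := fun ω => ∑ k ∈ Finset.Icc 1 n,
      stepNoise M (X ω) (polK H K δ η (X ω) k) (g k ω) k h with hSdef
    set G : Ω → ℝ := fun ω =>
      stepAvg M (polK H K δ η (X ω) (n + 1)) h ((X ω).state (n + 1) h) (g (n + 1) ω) with hGdef
    have hobs := observed_histState (H := H) (X := X) (k := n + 1) (h := h)
    have hG : Measurable[histState H X (n + 1) h] G :=
      hobs.measurable_stepAvg M h1 hh (fun s => measurableSet_state_histState s)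
        (hg (n + 1) (by omega))
    have hGb : ∀ ω, |G ω| ≤ c := fun ω => abs_le.2
      ⟨le_stepAvg (polK_mem _ _ _ _ _ _ _ _) fun a y => (abs_le.1 (hgc (n + 1) ω a y)).1,
        stepAvg_le (polK_mem _ _ _ _ _ _ _ _) fun a y => (abs_le.1 (hgc (n + 1) ω a y)).2⟩
    have hb : ∀ ω a y, |S ω + (g (n + 1) ω a y - G ω)| ≤ n * (2 * c) + 2 * c := by
      intro ω a y
      have b1 := abs_le.1 (hSb ω)
      have b2 := abs_le.1 (hgc (n + 1) ω a y)
      have b3 := abs_le.1 (hGb ω)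
      exact abs_le.2 ⟨by linarith, by linarith⟩
    have hm : ∀ a y, Measurable[histState H X (n + 1) h]
        fun ω => Real.exp (t * (S ω + (g (n + 1) ω a y - G ω))) := fun a y =>
      Real.measurable_exp.comp ((hS.add ((hg (n + 1) (by omega) a y).sub hG)).const_mul t)
    have hstep := hX.integral_step (k := n + 1) (by omega) hn h1 hh hm
      (fun ω a y => exp_mul_le (t := t) (hb ω a y))
    have hSint : Integrable (fun ω => Real.exp (t * S ω)) μ :=
      integrable_of_abs_le (Real.measurable_exp.comp
        ((hS.mono (hX.histState_le _ _) le_rfl).const_mul t)) fun ω => exp_mul_le (hSb ω)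
    calc _ = ∫ ω, Real.exp (t * (S ω + (g (n + 1) ω ((X ω).act (n + 1) h)
          ((X ω).state (n + 1) (h + 1)) - G ω))) ∂μ := by
          simp only [Finset.sum_Icc_succ_top (show 1 ≤ n + 1 by omega)]
          rfl
      _ = _ := hstep
      _ ≤ ∫ ω, Real.exp (t * S ω) * Real.exp (2 * (t * c) ^ 2) ∂μ := by
          refine integral_mono_of_nonneg (Filter.Eventually.of_forall fun ω =>
            le_stepAvg (polK_mem _ _ _ _ _ _ _ _) fun a y => (Real.exp_pos _).le)
            (hSint.mul_const _) (Filter.Eventually.of_forall fun ω => ?_)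
          have e : stepAvg M (polK H K δ η (X ω) (n + 1)) h ((X ω).state (n + 1) h)
              (fun a y => Real.exp (t * (S ω + (g (n + 1) ω a y - G ω))))
              = Real.exp (t * S ω) * stepAvg M (polK H K δ η (X ω) (n + 1)) h
                ((X ω).state (n + 1) h) (fun a y => Real.exp (t * (g (n + 1) ω a y - G ω))) := by
            simp only [stepAvg, Finset.mul_sum, mul_add, Real.exp_add]
            refine Finset.sum_congr rfl fun a _ => Finset.sum_congr rfl fun y _ => by ring
          show stepAvg M (polK H K δ η (X ω) (n + 1)) h ((X ω).state (n + 1) h)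
              (fun a y => Real.exp (t * (S ω + (g (n + 1) ω a y - G ω)))) ≤ _
          rw [e]
          exact mul_le_mul_of_nonneg_left (stepAvg_exp_le (polK_mem _ _ _ _ _ _ _ _) hc
            (hgc (n + 1) ω) t) (Real.exp_pos _).le
      _ = (∫ ω, Real.exp (t * S ω) ∂μ) * Real.exp (2 * (t * c) ^ 2) := integral_mul_const _ _
      _ ≤ Real.exp (n * (2 * (t * c) ^ 2)) * Real.exp (2 * (t * c) ^ 2) := by gcongr
      _ = _ := by
          rw [← Real.exp_add]
          congr 1
          push_cast
          ring

/-- The upper tail of the sums of noise. -/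
theorem IsRun.measure_sum_stepNoise_le (hX : IsRun M H K δ η s₁ μ X) (h1 : 1 ≤ h) (hh : h ≤ H)
    (hg : ∀ k, 1 ≤ k → ∀ a y, Measurable[histState H X k h] fun ω => g k ω a y) (hc : 0 < c)
    (hgc : ∀ k ω a y, |g k ω a y| ≤ c) (l : ℝ) {n : ℕ} (hn1 : 1 ≤ n) (hn : n ≤ K) :
    μ.real {ω | 2 * c * √n * (l + 1 / 2) ≤ ∑ k ∈ Finset.Icc 1 n,
      stepNoise M (X ω) (polK H K δ η (X ω) k) (g k ω) k h} ≤ Real.exp (-l) := by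
  have hn0 : (0 : ℝ) < n := by exact_mod_cast hn1
  have hsn : 0 < √(n : ℝ) := Real.sqrt_pos.2 hn0
  have hsq : √(n : ℝ) ^ 2 = n := Real.sq_sqrt hn0.le
  -- With this choice the exponential moment is at most `exp (1 / 2)`, which the summand `1 / 2` in
  -- the threshold cancels exactly.
  set t : ℝ := 1 / (2 * c * √n) with ht
  have ht0 : 0 < t := by positivity
  have hS := (measurable_sum_stepNoise (M := M) (K := K) (δ := δ) (η := η) h1 hh hg n).mono
    (hX.histState_le _ _) le_rfl
  have hint : Integrable (fun ω => Real.exp (t * ∑ k ∈ Finset.Icc 1 n,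
      stepNoise M (X ω) (polK H K δ η (X ω) k) (g k ω) k h)) μ :=
    integrable_of_abs_le (Real.measurable_exp.comp (hS.const_mul t)) fun ω =>
      exp_mul_le (abs_sum_stepNoise_le (M := M) (K := K) (δ := δ) (η := η) (h := h) (X := X)
        (H := H) hgc ω n)
  refine (ProbabilityTheory.measure_ge_le_exp_mul_mgf _ ht0.le hint).trans ?_
  have hmgf := hX.integral_exp_sum_le h1 hh hg hc hgc t hn
  rw [ProbabilityTheory.mgf]
  calc _ ≤ Real.exp (-t * (2 * c * √n * (l + 1 / 2))) * Real.exp (n * (2 * (t * c) ^ 2)) := by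
        gcongr
    _ = Real.exp (-l) := by
        rw [← Real.exp_add]
        congr 1
        have e1 : t * (2 * c * √n) = 1 := by
          rw [ht]
          field_simp
        have e2 : (n : ℝ) * (2 * (t * c) ^ 2) = (t * (2 * c * √n)) ^ 2 / 2 := by
          rw [mul_pow t (2 * c * √n), mul_pow (2 * c), hsq]
          ring
        rw [e2, show -t * (2 * c * √n * (l + 1 / 2)) = -(t * (2 * c * √n)) * (l + 1 / 2) by ring, e1]
        ring

end Noise

end Concentration

/-! ### The union bound. -/

section Main

variable {𝒮 𝒜 : Type*} [Fintype 𝒮] [DecidableEq 𝒮] [Fintype 𝒜] [DecidableEq 𝒜] [Nonempty 𝒜]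
  {Ω : Type*} {mΩ : MeasurableSpace Ω} {μ : Measure Ω} [IsProbabilityMeasure μ]
  {M : MDP 𝒮 𝒜} {H K : ℕ} {δ : ℝ} {η : ℕ → ℝ} {s₁ : 𝒮} {X : Ω → Record 𝒮 𝒜}

variable (M H K δ η X) in
/-- One of the two noise sums of step `h` up to episode `n` is large. -/
def noiseEvent (h n : ℕ) : Set Ω :=
  {ω | 2 * (3 * (H : ℝ)) * √n * (logFactor 𝒮 𝒜 H K δ + 1 / 2) ≤ ∑ k ∈ Finset.Icc 1 n,
      stepNoise M (X ω) (polK H K δ η (X ω) k) (widthFn M H K δ η (X ω) k h) k h} ∪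
    {ω | 2 * (H : ℝ) * √n * (logFactor 𝒮 𝒜 H K δ + 1 / 2) ≤ ∑ k ∈ Finset.Icc 1 n,
      stepNoise M (X ω) (polK H K δ η (X ω) k) (gapFn M H K δ η (X ω) k h) k h}

theorem IsRun.measure_noiseEvent_le [Nonempty 𝒮] (hX : IsRun M H K δ η s₁ μ X) (hδ : 0 < δ)
    (hδ1 : δ < 1) {h n : ℕ} (h1 : 1 ≤ h) (hh : h ≤ H) (hn1 : 1 ≤ n) (hn : n ≤ K) :
    μ.real (noiseEvent M H K δ η X h n) ≤ 2 * Real.exp (-logFactor 𝒮 𝒜 H K δ) := by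
  have hH : 1 ≤ H := h1.trans hh
  have hK : 1 ≤ K := hn1.trans hn
  have hH' : (0 : ℝ) < H := by exact_mod_cast hH
  have e1 := hX.measure_sum_stepNoise_le h1 hh
    (g := fun k ω => widthFn M H K δ η (X ω) k h) (c := 3 * H)
    (fun k _ a y => observed_histState.measurable_widthFn M h1 hh
      (fun s => measurableSet_state_histState s) a y) (by positivity)
    (fun k ω a y => abs_widthFn_le hH hK hδ hδ1 hh a y) (logFactor 𝒮 𝒜 H K δ) hn1 hn
  have e2 := hX.measure_sum_stepNoise_le h1 hh
    (g := fun k ω => gapFn M H K δ η (X ω) k h) (c := H)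
    (fun k _ a y => observed_histState.measurable_gapFn M hh a y) hH'
    (fun k ω a y => abs_gapFn_le hh a y) (logFactor 𝒮 𝒜 H K δ) hn1 hn
  refine (measureReal_union_le _ _).trans ?_
  linarith

/-- Each tail is `δ / (2 S A H K)`, and there are two of them for each of the `H K` pairs of step
and prefix length. -/
theorem mul_exp_neg_logFactor_le [Nonempty 𝒮] (hH : 1 ≤ H) (hK : 1 ≤ K) (hδ : 0 < δ) :
    (H * K : ℝ) * (2 * Real.exp (-logFactor 𝒮 𝒜 H K δ)) ≤ δ := by
  have hS : (1 : ℝ) ≤ Fintype.card 𝒮 := by exact_mod_cast Fintype.card_pos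
  have hA : (1 : ℝ) ≤ Fintype.card 𝒜 := by exact_mod_cast Fintype.card_pos
  have hK' : (0 : ℝ) < K := by exact_mod_cast hK
  have hH' : (0 : ℝ) < H := by exact_mod_cast hH
  rw [logFactor, Real.exp_neg, Real.exp_log (by positivity), inv_div]
  calc (H * K : ℝ) * (2 * (δ / (2 * Fintype.card 𝒮 * Fintype.card 𝒜 * H * K)))
      = δ / (Fintype.card 𝒮 * Fintype.card 𝒜) := by field_simp
    _ ≤ δ := div_le_self hδ.le (one_le_mul_of_one_le_of_one_le hS hA)

theorem IsRun.measure_iUnion_noiseEvent_le [Nonempty 𝒮] (hX : IsRun M H K δ η s₁ μ X)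
    (hδ : 0 < δ) (hδ1 : δ < 1) (hH : 1 ≤ H) (hK : 1 ≤ K) :
    μ (⋃ z ∈ Finset.Icc 1 H ×ˢ Finset.Icc 1 K, noiseEvent M H K δ η X z.1 z.2)
      ≤ ENNReal.ofReal δ := by
  rw [← ofReal_measureReal (measure_ne_top _ _)]
  refine ENNReal.ofReal_le_ofReal ((measureReal_biUnion_finset_le _ _).trans ?_)
  calc _ ≤ ∑ z ∈ Finset.Icc 1 H ×ˢ Finset.Icc 1 K, 2 * Real.exp (-logFactor 𝒮 𝒜 H K δ) := by
        refine Finset.sum_le_sum fun z hz => ?_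
        simp only [Finset.mem_product, Finset.mem_Icc] at hz
        exact hX.measure_noiseEvent_le hδ hδ1 hz.1.1 hz.1.2 hz.2.1 hz.2.2
    _ = (H * K : ℝ) * (2 * Real.exp (-logFactor 𝒮 𝒜 H K δ)) := by simp
    _ ≤ δ := mul_exp_neg_logFactor_le hH hK hδ

end Main

end RPOSAT

end

/-! ### The main theorem. -/

open RPOSAT in
theorem mainTheorem3 (c₁ c₂ : ℝ) (hc₁ : 0 < c₁) (hc₂ : c₁ ≤ c₂) :
    ∃ (C : ℝ) (p : ℕ), 0 < C ∧
      ∀ (𝒮 𝒜 : Type*) [Fintype 𝒮] [DecidableEq 𝒮] [Fintype 𝒜] [DecidableEq 𝒜] [Nonempty 𝒜]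
        (H K : ℕ) (δ : ℝ) (η : ℕ → ℝ) (M : RPOSAT.MDP 𝒮 𝒜) (s₁ : 𝒮)
        (Ω : Type*) [MeasurableSpace Ω] (μ : MeasureTheory.Measure Ω)
        [MeasureTheory.IsProbabilityMeasure μ] (X : Ω → RPOSAT.Record 𝒮 𝒜),
        0 < δ → δ < 1 →
        (∀ t, 1 ≤ t → t < K → η (t + 1) ≤ η t) →
        (∀ t : ℕ, 1 ≤ t → t ≤ K →
          c₁ * √(1 / ((H : ℝ) ^ 2 * Fintype.card 𝒜 * t)) ≤ η t ∧
            η t ≤ c₂ * √(1 / ((H : ℝ) ^ 2 * Fintype.card 𝒜 * t))) →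
        RPOSAT.IsRun M H K δ η s₁ μ X →
        μ {ω | RPOSAT.Optimism M H K δ η (X ω) ∧
            ¬ ∀ K' h : ℕ, K' ≤ K → 1 ≤ h → h ≤ H →
              RPOSAT.regret M H K δ η (X ω) h K' ≤
                  C * Real.log (2 * Fintype.card 𝒮 * Fintype.card 𝒜 * H * K / δ) ^ p *
                    √((Fintype.card 𝒮 : ℝ) ^ 2 * Fintype.card 𝒜 * (H : ℝ) ^ 4 * K') ∧
                ∑ k ∈ Finset.Icc 1 K',
                    |RPOSAT.VK H K δ η (X ω) k h ((X ω).state k h)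
                      - RPOSAT.optValue M H h ((X ω).state k h)| ≤
                  C * Real.log (2 * Fintype.card 𝒮 * Fintype.card 𝒜 * H * K / δ) ^ p *
                    √((Fintype.card 𝒮 : ℝ) ^ 2 * Fintype.card 𝒜 * (H : ℝ) ^ 4 * K')}
          ≤ ENNReal.ofReal δ := by
  have hc₂' : 0 < c₂ := hc₁.trans_le hc₂
  refine ⟨150 + 4 / c₁ + 4 * c₂, 1, by positivity, ?_⟩
  intro 𝒮 𝒜 _ _ _ _ _ H K δ η M s₁ Ω _ μ _ X hδ hδ1 hanti hη hX
  have : Nonempty 𝒮 := ⟨s₁⟩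
  simp only [pow_one]
  -- The initial state is `s₁` only almost surely, so the bad event is compared with the noise event
  -- up to a null set.
  have hstart : ∀ᵐ ω ∂μ, ∀ k, 1 ≤ k → k ≤ K → (X ω).state k 1 = s₁ := by
    simp only [MeasureTheory.ae_all_iff]
    exact hX.start
  have hpoint : ∀ ω, (∀ k, 1 ≤ k → k ≤ K → (X ω).state k 1 = s₁) → Optimism M H K δ η (X ω) →
      ∀ n h : ℕ, n ≤ K → 1 ≤ h → h ≤ H → (1 ≤ n →
        ω ∉ ⋃ z ∈ Finset.Icc 1 H ×ˢ Finset.Icc 1 K, noiseEvent M H K δ η X z.1 z.2) →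
      regret M H K δ η (X ω) h n ≤ (150 + 4 / c₁ + 4 * c₂) * logFactor 𝒮 𝒜 H K δ
          * √((Fintype.card 𝒮 : ℝ) ^ 2 * Fintype.card 𝒜 * (H : ℝ) ^ 4 * n) ∧
        ∑ k ∈ Finset.Icc 1 n, |VK H K δ η (X ω) k h ((X ω).state k h)
            - optValue M H h ((X ω).state k h)|
          ≤ (150 + 4 / c₁ + 4 * c₂) * logFactor 𝒮 𝒜 H K δ
            * √((Fintype.card 𝒮 : ℝ) ^ 2 * Fintype.card 𝒜 * (H : ℝ) ^ 4 * n) := by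
    intro ω hω hopt n h hnK h1 hh hgood
    rcases Nat.eq_zero_or_pos n with rfl | (hn : 1 ≤ n)
    · simp [regret]
    · have hgood := hgood hn
      simp only [Set.mem_iUnion, Finset.mem_product, Finset.mem_Icc, not_exists] at hgood
      have hl := logFactor_ge (𝒮 := 𝒮) (𝒜 := 𝒜) (h1.trans hh) (hn.trans hnK) hδ hδ1
      -- As `l ≥ 1 / 2`, the thresholds `2 c √n (l + 1 / 2)` with `c = 3 H` and `c = H` are at most
      -- `12 l H √n` and `4 l H √n`.
      have hpos : 0 ≤ (H : ℝ) * √n * (logFactor 𝒮 𝒜 H K δ - 1 / 2) :=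
        mul_nonneg (by positivity) (by linarith)
      refine bounds_of_noise hc₁ hc₂' hδ hδ1 hanti hη hopt hω hn hnK (fun j hj hjH => ?_)
        (fun j hj hjH => ?_) h1 hh
      · have hnot := fun hc => hgood (j, n) ⟨⟨hj, hjH⟩, hn, hnK⟩ (Or.inl hc)
        rw [Set.mem_ofPred_eq] at hnot
        linarith [not_le.1 hnot]
      · have hnot := fun hc => hgood (j, n) ⟨⟨hj, hjH⟩, hn, hnK⟩ (Or.inr hc)
        rw [Set.mem_ofPred_eq] at hnot
        linarith [not_le.1 hnot]
  by_cases hHK : 1 ≤ H ∧ 1 ≤ K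
  · refine le_trans ?_ (hX.measure_iUnion_noiseEvent_le hδ hδ1 hHK.1 hHK.2)
    refine MeasureTheory.measure_mono_ae ?_
    filter_upwards [hstart] with ω hω hbad
    by_contra hnot
    exact hbad.2 fun n h hnK h1 hh => hpoint ω hω hbad.1 n h hnK h1 hh fun _ => hnot
  -- If `H` or `K` is zero, there is no step or only the empty sum to consider, so the bad event is
  -- null.
  · refine le_trans (le_of_eq ?_) zero_le
    refine MeasureTheory.measure_mono_null ?_ hstart
    intro ω hbad hω
    exact hbad.2 fun n h hnK h1 hh => hpoint ω hω hbad.1 n h hnK h1 hh fun hn =>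
      absurd ⟨h1.trans hh, hn.trans hnK⟩ hHK
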